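/- Let $2\le k<n$ and consider the multinomial-logit model on items $[n]$ with parameters $\theta_i>0$, $\theta_1\ge\dots\ge\theta_k>\theta_{k+1}\ge\dots\ge\theta_n$: from a set $S$ of $k$ items, the ranking feedback $\sigma$ has probability $\prod_{a=1}^{k}\theta_{\sigma(a)}/\sum_{j\in S\setminus\{\sigma(1),\dots,\sigma(a-1)\}}\theta_j$. Put $p_{ij}=\frac{\theta_i}{\theta_i+\theta_j}$, and let $R_T^k=\sum_{t=1}^T\frac1k\big(\sum_{i\le k}\theta_i-\sum_{i\in S_t}\theta_i\big)$ be the Top-$k$-regret of the algorithm Rec-MaxMin-UCB with parameter $\alpha$, which plays sets $S_t$, $|S_t|=k$, as follows. It keeps counts $w_{ij}$ of how often $i$ was ranked above $j$ (initially $0$), $n_{ij}=w_{ij}+w_{ji}$, and slots $B(1),\dots,B(k)$ (initially empty). In round $t$ let $u_{ii}=\frac12$ and, for $i\ne j$, $u_{ij}=\frac{w_{ij}}{n_{ij}}+\sqrt{\frac{\alpha\ln t}{n_{ij}}}$ if $n_{ij}>0$ and $u_{ij}=u_0$ if $n_{ij}=0$, with any fixed $u_0\in[1,\infty]$. For a pool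 $I$ let $C(I)=\{i\in I: u_{ij}>\frac12\ \forall j\in I\setminus\{i\}\}$, and let $\bar C(I)=C(I)$ if $C(I)\neq\emptyset$ and $\bar C(I)=I$ otherwise. The subroutine build$(S,I,\ell)$ adds $\ell$ items of $I$ to $S$: while $|\bar C(I)|<\ell$, it moves $\bar C(I)$ from $I$ to $S$ and decreases $\ell$ by $|\bar C(I)|$; then, with $C=\bar C(I)$, it moves $\ell$ times an item of $\arg\max_{c\in C}\min_{i\in S}u_{ci}$ from $C$ to $S$ (a minimum over $\emptyset$ is $+\infty$). Starting from $S=\emptyset$, $I=[n]$, for $h=1,\dots,k-1$: if the item of the previous round's slot $B(h)$ is in $C(I)$, it stays in $B(h)$ and is moved from $I$ to $S$. Otherwise the round's choice ends with $S_t=$ build$(S,I,k-|S|)$; the slots after $h$ are empty, and $B(h)$ holds the item that build$(S,I,1)$ adds if $C(I)\ne\emptyset$, and is empty if $C(I)=\emptyset$. If all $k-1$ slots were kept, then $S_t=S\cup C(I)$ and $B(k)$ holds the element of $C(I)$ if $|C(I)|=1$; otherwise $S_t=$ build$(S,I,1)$ and the previous item of $B(k)$ stays if it is in $C(I)$, else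 $B(k)$ is empty. Then $S_t$ is played, and for each pair of its items the count of the one ranked higher is increased. Ties are broken by an arbitrary rule that may depend on the past rankings, on $S$ and on the set of maximizers. If $\alpha>1$ then, for every such rule and every $T$, $$\mathbf E[R_T^k]\le\Big(2\Big[\frac{2\alpha n^2}{2\alpha-1}\Big]^{\frac1{2\alpha-1}}\frac{2\alpha-1}{\alpha-1}+2\bar D^{(k)}\ln(2\bar D^{(k)})\Big)\Delta'_{\max}+\frac{4\alpha\ln T}{k}\sum_{b=k+1}^n\frac{\theta_k-\theta_b}{\hat D_b^2},$$ where $\Delta'_{\max}=\frac1k\big(\sum_{i=1}^k\theta_i-\sum_{i=n-k+1}^n\theta_i\big)$, $\hat D_b=\min_{g\in[k-1]}(p_{kg}-p_{bg})$, and $\bar D^{(k)}=\sum_{r=1}^k\ \sum_{j:\theta_j<\theta_r}\ \sum_{i\in[n]\setminus\{j\}}D^r_{ij}$ with, for $\theta_j<\theta_g$: $D^g_{ij}=\frac{4\alpha}{\min((p_{gi}-1/2)^2,(p_{gj}-1/2)^2)}$ if $\theta_i<\theta_g$, $D^g_{ij}=\frac{4\alpha}{(p_{gi}-p_{ji})^2}$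 if $\theta_i>\theta_g$, and $D^g_{ij}=\frac{4\alpha}{(p_{gj}-1/2)^2}$ if $\theta_i=\theta_g$. -/

import Mathlib

/-! Combinatorial bandits with multinomial-logit (MNL) ranking feedback and the algorithm
Rec-MaxMin-UCB.  Items are `Fin n`, numbered from `0`: item `i` of the usual numbering
`1, …, n` is the one with value `i - 1`. -/

namespace RecMaxMin

noncomputable section

open Finset

/-! ### The MNL model and its ranking feedback -/

/-- MNL choice probability `Pr(i | S)`. -/
def winProb {n : ℕ} (θ : Fin n → ℝ) (S : Finset (Fin n)) (i : Fin n) : ℝ :=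
  if i ∈ S then θ i / ∑ j ∈ S, θ j else 0

/-- Probability of the ordered list `σ` of `m` items under top-`m`-ranking feedback from `S`:
the items are drawn one after the other, without replacement, from the MNL model.  It vanishes
unless `σ` lists distinct items of `S`. -/
def rankProb {n m : ℕ} (θ : Fin n → ℝ) (S : Finset (Fin n)) (σ : Fin m → Fin n) : ℝ :=
  ∏ a : Fin m, winProb θ (S \ (univ.filter (· < a)).image σ) (σ a)

theorem winProb_nonneg {n : ℕ} {θ : Fin n → ℝ} (hθ : ∀ i, 0 < θ i) (S : Finset (Fin n))
    (i : Fin n) : 0 ≤ winProb θ S i := by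
  unfold winProb
  split_ifs
  · exact div_nonneg (hθ i).le (Finset.sum_nonneg fun j _ => (hθ j).le)
  · exact le_rfl

theorem rankProb_nonneg {n m : ℕ} {θ : Fin n → ℝ} (hθ : ∀ i, 0 < θ i) (S : Finset (Fin n))
    (σ : Fin m → Fin n) : 0 ≤ rankProb θ S σ :=
  Finset.prod_nonneg fun _ _ => winProb_nonneg hθ _ _

theorem sum_winProb {n : ℕ} {θ : Fin n → ℝ} (hθ : ∀ i, 0 < θ i) {S : Finset (Fin n)}
    (hS : S.Nonempty) : ∑ i, winProb θ S i = 1 := by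
  have hpos : 0 < ∑ j ∈ S, θ j := Finset.sum_pos (fun j _ => hθ j) hS
  unfold winProb
  rw [Finset.sum_ite_mem, Finset.univ_inter, ← Finset.sum_div, div_self hpos.ne']

theorem rankProb_cons {n m : ℕ} (θ : Fin n → ℝ) (S : Finset (Fin n)) (i : Fin n)
    (σ : Fin m → Fin n) :
    rankProb θ S (Fin.cons i σ : Fin (m + 1) → Fin n)
      = winProb θ S i * rankProb θ (S.erase i) σ := by
  unfold rankProb
  rw [Fin.prod_univ_succ]
  congr 1
  · simp
  · refine Finset.prod_congr rfl fun a _ => ?_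
    congr 1
    ext x
    simp only [mem_sdiff, mem_image, mem_filter, mem_univ, true_and, mem_erase, not_exists,
      not_and]
    constructor
    · rintro ⟨hx, h⟩
      refine ⟨⟨fun e => h 0 (Fin.succ_pos a) (by simp [e]), hx⟩, fun c hc e => ?_⟩
      exact h c.succ (Fin.succ_lt_succ_iff.2 hc) (by simpa using e)
    · rintro ⟨⟨hxi, hx⟩, h⟩
      refine ⟨hx, fun c => ?_⟩
      refine Fin.cases ?_ (fun c => ?_) c
      · intro _ e
        exact hxi (by simpa using e.symm)
      · intro hc e
        exact h c (Fin.succ_lt_succ_iff.1 hc) (by simpa using e)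

theorem sum_rankProb {n : ℕ} {θ : Fin n → ℝ} (hθ : ∀ i, 0 < θ i) (m : ℕ) :
    ∀ S : Finset (Fin n), m ≤ S.card → ∑ σ : Fin m → Fin n, rankProb θ S σ = 1 := by
  induction m with
  | zero =>
    intro S _
    simp [rankProb]
  | succ m ih =>
    intro S hS
    have hne : S.Nonempty := Finset.card_pos.1 (by omega)
    rw [← (Fin.consEquiv (fun _ => Fin n)).sum_comp, Fintype.sum_prod_type]
    rw [← sum_winProb hθ hne]
    refine Finset.sum_congr rfl fun i _ => ?_
    change ∑ σ : Fin m → Fin n, rankProb θ S (Fin.cons i σ : Fin (m + 1) → Fin n) = _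
    simp only [rankProb_cons]
    by_cases hi : i ∈ S
    · rw [← Finset.mul_sum, ih _ (by rw [Finset.card_erase_of_mem hi]; omega), mul_one]
    · simp [winProb, hi]

/-- The law of the top-`m`-ranking feedback from a set `S` of at least `m` items. -/
def rankPMF {n : ℕ} {θ : Fin n → ℝ} (hθ : ∀ i, 0 < θ i) (m : ℕ) (S : Finset (Fin n))
    (hS : m ≤ S.card) : PMF (Fin m → Fin n) :=
  PMF.ofFintype (fun σ => ENNReal.ofReal (rankProb θ S σ)) (by
    rw [← ENNReal.ofReal_sum_of_nonneg fun σ _ => rankProb_nonneg hθ S σ,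
      sum_rankProb hθ m S hS, ENNReal.ofReal_one])

/-! ### The algorithm Rec-MaxMin-UCB -/

/-- Upper confidence bounds at round `t`, where `W i j` counts the wins of `i` over `j`.
Pairs that were never compared get the optimistic value `u₀` (such as `2` or `+∞`). -/
def ucb {n : ℕ} (α : ℝ) (u₀ : EReal) (t : ℕ) (W : Fin n → Fin n → ℕ) (i j : Fin n) : EReal :=
  if i = j then ((1 / 2 : ℝ) : EReal)
  else if W i j + W j i = 0 then u₀
  else (((W i j : ℝ) / ((W i j : ℝ) + (W j i : ℝ))
    + Real.sqrt (α * Real.log t / ((W i j : ℝ) + (W j i : ℝ))) : ℝ) : EReal)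

/-- The potential Condorcet winners `𝒞` of a pool `I`. -/
def cand {n : ℕ} (U : Fin n → Fin n → EReal) (I : Finset (Fin n)) : Finset (Fin n) :=
  I.filter fun i => ∀ j ∈ I, j ≠ i → ((1 / 2 : ℝ) : EReal) < U i j

/-- The set `𝒞`, replaced by the whole pool `I` if it is empty. -/
def pool {n : ℕ} (U : Fin n → Fin n → EReal) (I : Finset (Fin n)) : Finset (Fin n) :=
  if cand U I = ∅ then I else cand U I

/-- The maximizers over `c ∈ C` of `min_{i ∈ S} u_{ci}` (a minimum over `∅` being `+∞`). -/
def maxMin {n : ℕ} (U : Fin n → Fin n → EReal) (S C : Finset (Fin n)) : Finset (Fin n) :=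
  C.filter fun c => ∀ c' ∈ C, S.inf (U c') ≤ S.inf (U c)

/-- A rule that selects one element of each non-empty set `A` of maximizers; the choice may
depend on the set `S` built so far. -/
structure TieRule (n : ℕ) where
  /-- the selected item -/
  sel : Finset (Fin n) → Finset (Fin n) → Fin n
  sel_mem : ∀ S A, A.Nonempty → sel S A ∈ A

/-- One max-min draw from `C`, given the set `S` built so far. -/
def pick {n : ℕ} (τ : TieRule n) (U : Fin n → Fin n → EReal) (S C : Finset (Fin n)) : Fin n :=
  τ.sel S (maxMin U S C)

/-- Adds to `S` successively `ℓ` items drawn from `C` by the max-min rule. -/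
def drawMany {n : ℕ} (τ : TieRule n) (U : Fin n → Fin n → EReal) :
    ℕ → Finset (Fin n) → Finset (Fin n) → Finset (Fin n)
  | 0, S, _ => S
  | ℓ + 1, S, C => drawMany τ U ℓ (insert (pick τ U S C) S) (C.erase (pick τ U S C))

theorem pool_subset {n : ℕ} (U : Fin n → Fin n → EReal) (I : Finset (Fin n)) :
    pool U I ⊆ I := by
  unfold pool
  split_ifs
  · exact Finset.Subset.refl I
  · exact Finset.filter_subset _ _

theorem pool_nonempty {n : ℕ} (U : Fin n → Fin n → EReal) {I : Finset (Fin n)}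
    (hI : I.Nonempty) : (pool U I).Nonempty := by
  unfold pool
  split_ifs with h
  · exact hI
  · exact Finset.nonempty_iff_ne_empty.2 h

/-- The set building rule `build_S`: adds `ℓ` items of the pool `I` to `S`.  As long as there
are fewer than `ℓ` potential Condorcet winners in the pool, all of them are moved from the pool
to `S`; the rest is drawn from the potential Condorcet winners by the max-min rule. -/
def buildS {n : ℕ} (τ : TieRule n) (U : Fin n → Fin n → EReal)
    (S I : Finset (Fin n)) (ℓ : ℕ) : Finset (Fin n) :=
  if _h : (pool U I).card < ℓ ∧ I.Nonempty then
    buildS τ U (S ∪ pool U I) (I \ pool U I) (ℓ - (pool U I).card)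
  else drawMany τ U ℓ S (pool U I)
termination_by I.card
decreasing_by
  have h1 := Finset.card_sdiff_add_card_eq_card (pool_subset U I)
  have h2 := Finset.card_pos.2 (pool_nonempty U _h.2)
  omega

/-- The slots of one round, from slot `h` on, where `m` is the number of slots strictly between
`h` and the end of the list of `k` slots (slots are numbered from `0`, so the last one has
`m = 0`), `S` is the set built so far, `I` the remaining pool and `B` the slots of the previous
round (`none` is an empty slot).  Returns the new slots and the set to be played. -/
def fillSlots {n : ℕ} (τ : TieRule n) (k : ℕ) (U : Fin n → Fin n → EReal)
    (B : ℕ → Option (Fin n)) :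
    (m h : ℕ) → (S I : Finset (Fin n)) → (ℕ → Option (Fin n)) × Finset (Fin n)
  | 0, h, S, I =>
      if (cand U I).card = 1 then
        (Function.update (fun _ => none) h (some (pick τ U S (cand U I))), S ∪ cand U I)
      else
        (Function.update (fun _ => none) h ((B h).filter fun b => decide (b ∈ cand U I)),
          buildS τ U S I 1)
  | m + 1, h, S, I =>
      match (B h).filter fun b => decide (b ∈ cand U I) with
      | some b =>
          let r := fillSlots τ k U B m (h + 1) (insert b S) (I.erase b)
          (Function.update r.1 h (some b), r.2)
      | none =>
          if cand U I = ∅ then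
            (fun _ => none, buildS τ U S I (k - S.card))
          else
            -- the item that `build_S` adds when it is asked for a single one
            (Function.update (fun _ => none) h (some (pick τ U S (cand U I))),
              buildS τ U S I (k - S.card))

/-- What the algorithm remembers between rounds. -/
structure Memory (n : ℕ) where
  /-- pairwise win counts -/
  W : Fin n → Fin n → ℕ
  /-- the slots `ℬ(1), …, ℬ(k)`, numbered from `0` -/
  B : ℕ → Option (Fin n)

/-- Slots and played set of round `t`. -/
def plan {n : ℕ} (α : ℝ) (u₀ : EReal) (k : ℕ) (τ : TieRule n) (t : ℕ) (M : Memory n) :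
    (ℕ → Option (Fin n)) × Finset (Fin n) :=
  fillSlots τ k (ucb α u₀ t M.W) M.B (k - 1) 0 ∅ univ

open Classical in
/-- Rank-breaking: `i` beats `j` if `i` precedes `j` in the ranking `σ`. -/
def breakRank {n k : ℕ} (σ : Fin k → Fin n) (i j : Fin n) : ℕ :=
  if ∃ a b : Fin k, a < b ∧ σ a = i ∧ σ b = j then 1 else 0

/-- A family of tie-breaking rules, one for each history of rankings received so far. -/
abbrev HistRule (n k : ℕ) := (t : ℕ) → (Fin t → Fin k → Fin n) → TieRule n

/-- Memory of the algorithm after the `t` rounds with rankings `h 0, …, h (t - 1)`. -/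
def memory {n k : ℕ} (α : ℝ) (u₀ : EReal) (τ : HistRule n k) :
    (t : ℕ) → (Fin t → Fin k → Fin n) → Memory n
  | 0, _ => ⟨fun _ _ => 0, fun _ => none⟩
  | t + 1, h =>
      let M := memory α u₀ τ t (Fin.init h)
      ⟨fun i j => M.W i j + breakRank (h (Fin.last t)) i j,
        (plan α u₀ k (τ t (Fin.init h)) (t + 1) M).1⟩

/-- The set played in round `t + 1`, after the history `h` of the first `t` rounds. -/
def played {n k : ℕ} (α : ℝ) (u₀ : EReal) (τ : HistRule n k) (t : ℕ)
    (h : Fin t → Fin k → Fin n) : Finset (Fin n) :=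
  (plan α u₀ k (τ t h) (t + 1) (memory α u₀ τ t h)).2

theorem maxMin_nonempty {n : ℕ} (U : Fin n → Fin n → EReal) (S : Finset (Fin n))
    {C : Finset (Fin n)} (hC : C.Nonempty) : (maxMin U S C).Nonempty := by
  obtain ⟨c, hc, h⟩ := Finset.exists_max_image C (fun c => S.inf (U c)) hC
  exact ⟨c, Finset.mem_filter.2 ⟨hc, h⟩⟩

theorem pick_mem {n : ℕ} (τ : TieRule n) (U : Fin n → Fin n → EReal) (S : Finset (Fin n))
    {C : Finset (Fin n)} (hC : C.Nonempty) : pick τ U S C ∈ C :=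
  (Finset.mem_filter.1 (τ.sel_mem S _ (maxMin_nonempty U S hC))).1

theorem card_drawMany {n : ℕ} (τ : TieRule n) (U : Fin n → Fin n → EReal) (ℓ : ℕ) :
    ∀ S C : Finset (Fin n), Disjoint S C → ℓ ≤ C.card →
      (drawMany τ U ℓ S C).card = S.card + ℓ := by
  induction ℓ with
  | zero => intro S C _ _; rfl
  | succ ℓ ih =>
    intro S C hd hl
    have hp := pick_mem τ U S (C := C) (Finset.card_pos.1 (by omega))
    have hpS : pick τ U S C ∉ S := fun h => Finset.disjoint_left.1 hd h hp
    rw [drawMany, ih, Finset.card_insert_of_notMem hpS]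
    · omega
    · rw [Finset.disjoint_insert_left]
      exact ⟨Finset.notMem_erase _ _, hd.mono_right (Finset.erase_subset _ _)⟩
    · rw [Finset.card_erase_of_mem hp]; omega

theorem card_buildS {n : ℕ} (τ : TieRule n) (U : Fin n → Fin n → EReal) (S I : Finset (Fin n))
    (ℓ : ℕ) (hd : Disjoint S I) (hl : ℓ ≤ I.card) : (buildS τ U S I ℓ).card = S.card + ℓ := by
  induction S, I, ℓ using buildS.induct (U := U) with
  | case1 S I ℓ h ih =>
    have hsub := pool_subset U I
    have h1 := Finset.card_sdiff_add_card_eq_card hsub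
    have h2 : (S ∪ pool U I).card = S.card + (pool U I).card :=
      Finset.card_union_of_disjoint (hd.mono_right hsub)
    rw [buildS, dif_pos h, ih, h2]
    · omega
    · rw [Finset.disjoint_union_left]
      exact ⟨hd.mono_right Finset.sdiff_subset, Finset.disjoint_sdiff⟩
    · omega
  | case2 S I ℓ h =>
    rw [buildS, dif_neg h]
    refine card_drawMany τ U ℓ S _ (hd.mono_right (pool_subset U I)) ?_
    by_contra hlt
    exact h ⟨by omega, Finset.card_pos.1 (by omega)⟩

theorem card_fillSlots {n : ℕ} (τ : TieRule n) (k : ℕ) (hkn : k ≤ n)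
    (U : Fin n → Fin n → EReal) (B : ℕ → Option (Fin n)) (m : ℕ) :
    ∀ (h : ℕ) (S I : Finset (Fin n)), Disjoint S I → S.card + I.card = n →
      S.card + (m + 1) = k → (fillSlots τ k U B m h S I).2.card = k := by
  induction m with
  | zero =>
    intro h S I hd hc hk
    rw [fillSlots]
    split_ifs with h1
    · have h2 : (S ∪ cand U I).card = S.card + (cand U I).card :=
        Finset.card_union_of_disjoint (hd.mono_right (Finset.filter_subset _ I))
      change (S ∪ cand U I).card = k
      omega
    · simp only [card_buildS τ U S I 1 hd (by omega)]
      omega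
  | succ m ih =>
    intro h S I hd hc hk
    rw [fillSlots]
    split
    · next b hb =>
      have hbI : b ∈ I := by
        have h2 := (Option.filter_eq_some_iff.1 hb).2
        exact (Finset.mem_filter.1 (of_decide_eq_true h2)).1
      have hbS : b ∉ S := fun hS => Finset.disjoint_left.1 hd hS hbI
      have hcI : (I.erase b).card = I.card - 1 := Finset.card_erase_of_mem hbI
      have hIpos : 0 < I.card := Finset.card_pos.2 ⟨b, hbI⟩
      have hcS : (insert b S).card = S.card + 1 := Finset.card_insert_of_notMem hbS
      refine ih (h + 1) (insert b S) (I.erase b) ?_ (by omega) (by omega)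
      rw [Finset.disjoint_insert_left]
      exact ⟨Finset.notMem_erase _ _, hd.mono_right (Finset.erase_subset _ _)⟩
    · split_ifs <;> simp only [card_buildS τ U S I (k - S.card) hd (by omega)] <;> omega

theorem card_played {n k : ℕ} (hk : 1 ≤ k) (hkn : k ≤ n) (α : ℝ) (u₀ : EReal)
    (τ : HistRule n k) (t : ℕ) (h : Fin t → Fin k → Fin n) :
    (played α u₀ τ t h).card = k := by
  refine card_fillSlots _ k hkn _ _ (k - 1) 0 ∅ univ (Finset.disjoint_empty_left _) ?_ ?_
  · simp
  · simp only [Finset.card_empty]; omega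

/-! ### The interaction and the regret -/

/-- Joint law of the rankings received in the first `T` rounds: in each round, given the past,
the ranking is drawn from the MNL model on the set that the algorithm plays. -/
def law {n k : ℕ} {θ : Fin n → ℝ} (hθ : ∀ i, 0 < θ i) (hk : 1 ≤ k) (hkn : k ≤ n) (α : ℝ)
    (u₀ : EReal) (τ : HistRule n k) : (T : ℕ) → PMF (Fin T → Fin k → Fin n)
  | 0 => PMF.pure Fin.elim0
  | T + 1 => (law hθ hk hkn α u₀ τ T).bind fun h =>
      (rankPMF hθ k (played α u₀ τ T h) (card_played hk hkn α u₀ τ T h).ge).map fun σ =>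
        (Fin.snoc h σ : Fin (T + 1) → Fin k → Fin n)

/-- Instantaneous Top-`k`-regret of playing `S`, when the `k` best items are the first `k`. -/
def instRegret {n : ℕ} (θ : Fin n → ℝ) (k : ℕ) (S : Finset (Fin n)) : ℝ :=
  (∑ i with i.val < k, θ i - ∑ i ∈ S, θ i) / k

/-- Cumulative Top-`k`-regret of the algorithm over `T` rounds with rankings `h`. -/
def regret {n k : ℕ} (θ : Fin n → ℝ) (α : ℝ) (u₀ : EReal) (τ : HistRule n k) :
    (T : ℕ) → (Fin T → Fin k → Fin n) → ℝ
  | 0, _ => 0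
  | T + 1, h => regret θ α u₀ τ T (Fin.init h) + instRegret θ k (played α u₀ τ T (Fin.init h))

/-- Expected cumulative Top-`k`-regret of Rec-MaxMin-UCB over `T` rounds. -/
def expRegret {n k : ℕ} {θ : Fin n → ℝ} (hθ : ∀ i, 0 < θ i) (hk : 1 ≤ k) (hkn : k ≤ n) (α : ℝ)
    (u₀ : EReal) (τ : HistRule n k) (T : ℕ) : ℝ :=
  ∑ h : Fin T → Fin k → Fin n, (law hθ hk hkn α u₀ τ T h).toReal * regret θ α u₀ τ T h

/-! ### Problem-dependent constants -/

/-- Pairwise preference `p_{ij} = Pr(i | {i, j})`. -/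
def pref {n : ℕ} (θ : Fin n → ℝ) (i j : Fin n) : ℝ := θ i / (θ i + θ j)

/-- The largest instantaneous regret: first `k` items against the last `k` items. -/
def regretMax {n : ℕ} (θ : Fin n → ℝ) (k : ℕ) : ℝ :=
  (∑ i with i.val < k, θ i - ∑ i with n - k ≤ i.val, θ i) / k

/-- `D^g_{ij}` for an item `j` that is strictly worse than `g`. -/
def pairConst {n : ℕ} (α : ℝ) (θ : Fin n → ℝ) (g i j : Fin n) : ℝ :=
  if θ i < θ g then 4 * α / min ((pref θ g i - 1 / 2) ^ 2) ((pref θ g j - 1 / 2) ^ 2)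
  else if θ g < θ i then 4 * α / (pref θ g i - pref θ j i) ^ 2
  else 4 * α / (pref θ g j - 1 / 2) ^ 2

/-- `D̄^{(k)} = ∑_{r ∈ [k]} ∑_{j : θ_j < θ_r} ∑_{i ≠ j} D^r_{ij}`. -/
def progressConst {n : ℕ} (α : ℝ) (θ : Fin n → ℝ) (k : ℕ) : ℝ :=
  ∑ r with r.val < k, ∑ j with θ j < θ r, ∑ i with i ≠ j, pairConst α θ r i j

/-- `D̂_b = min_{g ∈ [k-1]} (p_{ag} - p_{bg})`, used with `a` the `k`-th best item, `k ≥ 2`. -/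
def gapConst {n : ℕ} (θ : Fin n → ℝ) (k : ℕ) (a b : Fin n) : ℝ :=
  ⨅ g : {g : Fin n // g.val + 1 < k}, (pref θ a g - pref θ b g)

end

end RecMaxMin

/-! The regret analysis of Rec-MaxMin-UCB splits the rounds at two random times.

The first time `N` (`lastFailure`) is that of the last round in which some confidence bound fails.
By independence of irrelevant alternatives (`sum_rankProb_mul_breakRank`), whatever set is played,
`i` is ranked above `j` with probability `p_{ij}`, so the comparisons of a pair form a sequence of
Bernoulli trials although the sets are chosen adaptively.  An exponential supermartingale, stopped
when a pair has been compared `m` times, turns this into Hoeffding's bound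
(`expect_overshoot_le`); summing over `m` and over the pairs bounds `P(N > c)` by
`2αn²/(2α-1) · c^{-(2α-1)}`, and summing over `c` bounds `E[N]` (`expect_lastFailure_le`).

The rest is deterministic.  After `N` every upper confidence bound strictly exceeds the preference
it estimates, so the best items of a pool are potential Condorcet winners (`best_mem_cand`).  Hence
an initial segment of slots that holds best items in decreasing order of `θ` (`TopSlots`) is kept
for ever.  In a round in which the first `k - 1` slots are not all of this kind, either one more
slot becomes so, or the played set contains a pair `i, j` that was compared at most
`D^g_{ij} ln t` times (`fillSlots_progress`).  The reason is that as long as no best item `a` of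
the pool is drawn, the max-min rule prefers the drawn item to `a`, so that the confidence bound of
the drawn item against the strongest item of the set is too large for a well explored pair.  Every
such pair is compared once more, so that the second time `s`, at which the first `k - 1` slots are
settled, satisfies `s ≤ N + D̄ ln s + O(1)`, and therefore `s ≤ 2N + 2D̄ ln (2D̄)`
(`le_of_le_add_mul_log`); the additive constants are absorbed since each `D^g_{ij}` is at least
`4`.

In a settled round a single further item `b` is drawn, at the price `(θ_k - θ_b)/k`.  If it is
worse than item `k`, then the max-min rule bounds the number of its comparisons with a best item,
which is in one of the slots, by `4α ln T / D̂_b²` (`IsRun.settled_regret_le`). -/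

namespace RecMaxMin

noncomputable section

open Finset

/-! ### Rank breaking: pairwise comparisons in a ranking -/

theorem mem_of_winProb_ne_zero {n : ℕ} {θ : Fin n → ℝ} {S : Finset (Fin n)} {i : Fin n}
    (h : winProb θ S i ≠ 0) : i ∈ S := by
  by_contra hi
  exact h (by simp [winProb, hi])

theorem mem_of_rankProb_ne_zero {n m : ℕ} {θ : Fin n → ℝ} {S : Finset (Fin n)}
    {σ : Fin m → Fin n} (h : rankProb θ S σ ≠ 0) (a : Fin m) : σ a ∈ S :=
  (mem_sdiff.1 (mem_of_winProb_ne_zero (Finset.prod_ne_zero_iff.1 h a (mem_univ a)))).1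

theorem injective_of_rankProb_ne_zero {n m : ℕ} {θ : Fin n → ℝ} {S : Finset (Fin n)}
    {σ : Fin m → Fin n} (h : rankProb θ S σ ≠ 0) : Function.Injective σ := by
  have key : ∀ a b : Fin m, a < b → σ a ≠ σ b := fun a b hab e =>
    (mem_sdiff.1 (mem_of_winProb_ne_zero (Finset.prod_ne_zero_iff.1 h b (mem_univ b)))).2
      (mem_image.2 ⟨a, by simpa using hab, e⟩)
  intro a b e
  rcases lt_trichotomy a b with h1 | h1 | h1
  · exact absurd e (key a b h1)
  · exact h1
  · exact absurd e.symm (key b a h1)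

theorem image_eq_of_rankProb_ne_zero {n m : ℕ} {θ : Fin n → ℝ} {S : Finset (Fin n)}
    {σ : Fin m → Fin n} (h : rankProb θ S σ ≠ 0) (hS : S.card = m) : univ.image σ = S := by
  refine Finset.eq_of_subset_of_card_le ?_ ?_
  · intro x hx
    obtain ⟨a, _, rfl⟩ := mem_image.1 hx
    exact mem_of_rankProb_ne_zero h a
  · rw [Finset.card_image_of_injective _ (injective_of_rankProb_ne_zero h)]
    simp [hS]

theorem breakRank_eq_zero_left {n m : ℕ} {σ : Fin m → Fin n} {i : Fin n} (j : Fin n)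
    (hi : ∀ a, σ a ≠ i) : breakRank σ i j = 0 := by
  unfold breakRank
  rw [if_neg]
  rintro ⟨a, b, _, h1, _⟩
  exact hi a h1

theorem breakRank_eq_zero_right {n m : ℕ} {σ : Fin m → Fin n} (i : Fin n) {j : Fin n}
    (hj : ∀ a, σ a ≠ j) : breakRank σ i j = 0 := by
  unfold breakRank
  rw [if_neg]
  rintro ⟨a, b, _, _, h1⟩
  exact hj b h1

theorem breakRank_dichotomy {n m : ℕ} {θ : Fin n → ℝ} {S : Finset (Fin n)}
    {σ : Fin m → Fin n} (h : rankProb θ S σ ≠ 0) (hS : S.card = m) {i j : Fin n} (hij : i ≠ j)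
    (hi : i ∈ S) (hj : j ∈ S) :
    (breakRank σ i j = 1 ∧ breakRank σ j i = 0) ∨ (breakRank σ i j = 0 ∧ breakRank σ j i = 1) := by
  have hinj := injective_of_rankProb_ne_zero h
  rw [← image_eq_of_rankProb_ne_zero h hS] at hi hj
  obtain ⟨a, _, rfl⟩ := mem_image.1 hi
  obtain ⟨b, _, rfl⟩ := mem_image.1 hj
  have key : ∀ a b : Fin m, breakRank σ (σ a) (σ b) = if a < b then 1 else 0 := by
    intro a b
    unfold breakRank
    refine if_congr ⟨?_, fun hab => ⟨a, b, hab, rfl, rfl⟩⟩ rfl rfl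
    rintro ⟨a', b', hab, h1, h2⟩
    rwa [← hinj h1, ← hinj h2]
  have hab : a ≠ b := fun e => hij (by rw [e])
  rw [key, key]
  rcases lt_or_gt_of_ne hab with h1 | h1
  · exact Or.inl ⟨if_pos h1, if_neg h1.not_gt⟩
  · exact Or.inr ⟨if_neg h1.not_gt, if_pos h1⟩

theorem breakRank_of_notMem {n m : ℕ} {θ : Fin n → ℝ} {S : Finset (Fin n)}
    {σ : Fin m → Fin n} (h : rankProb θ S σ ≠ 0) {i j : Fin n} (hij : ¬ (i ∈ S ∧ j ∈ S)) :
    breakRank σ i j = 0 := by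
  by_cases hi : i ∈ S
  · exact breakRank_eq_zero_right _ fun a e =>
      hij ⟨hi, e ▸ mem_of_rankProb_ne_zero h a⟩
  · exact breakRank_eq_zero_left _ fun a e => hi (e ▸ mem_of_rankProb_ne_zero h a)

theorem breakRank_cons_of_ne {n m : ℕ} (σ : Fin m → Fin n) {x i : Fin n} (j : Fin n)
    (hx : x ≠ i) : breakRank (Fin.cons x σ : Fin (m + 1) → Fin n) i j = breakRank σ i j := by
  unfold breakRank
  refine if_congr ⟨?_, ?_⟩ rfl rfl
  · rintro ⟨a, b, hab, h1, h2⟩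
    refine Fin.cases (fun _ h1 => absurd h1 hx) (fun a hab h1 => ?_) a hab h1
    refine Fin.cases (fun hab _ => absurd hab (Fin.not_lt_zero _)) (fun b hab h2 => ?_) b hab h2
    exact ⟨a, b, Fin.succ_lt_succ_iff.1 hab, by simpa using h1, by simpa using h2⟩
  · rintro ⟨a, b, hab, h1, h2⟩
    exact ⟨a.succ, b.succ, Fin.succ_lt_succ_iff.2 hab, by simpa using h1, by simpa using h2⟩

theorem breakRank_cons_self {n m : ℕ} (σ : Fin m → Fin n) {i j : Fin n}
    (hj : ∃ b, σ b = j) : breakRank (Fin.cons i σ : Fin (m + 1) → Fin n) i j = 1 := by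
  obtain ⟨b, hb⟩ := hj
  unfold breakRank
  exact if_pos ⟨0, b.succ, Fin.succ_pos b, rfl, by simpa using hb⟩

/-- Independence of irrelevant alternatives for rankings: under the MNL model, the probability
that `i` is ranked above `j` does not depend on the other items of the set. -/
theorem sum_rankProb_mul_breakRank {n : ℕ} {θ : Fin n → ℝ} (hθ : ∀ i, 0 < θ i) {i j : Fin n}
    (hij : i ≠ j) (m : ℕ) : ∀ S : Finset (Fin n), S.card = m → i ∈ S → j ∈ S →
      ∑ σ : Fin m → Fin n, rankProb θ S σ * (breakRank σ i j : ℝ) = pref θ i j := by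
  induction m with
  | zero =>
    intro S hS hi
    simp [Finset.card_eq_zero.1 hS] at hi
  | succ m ih =>
    intro S hS hi hj
    have hpos : 0 < ∑ x ∈ S, θ x := Finset.sum_pos (fun x _ => hθ x) ⟨i, hi⟩
    have hsum : ∀ x ∈ S, ∑ σ : Fin m → Fin n, rankProb θ S (Fin.cons x σ : Fin (m + 1) → Fin n)
        * (breakRank (Fin.cons x σ : Fin (m + 1) → Fin n) i j : ℝ)
        = (θ x / ∑ y ∈ S, θ y) * (if x = i then 1 else if x = j then 0 else pref θ i j) := by
      intro x hx
      have hc : (S.erase x).card = m := by rw [Finset.card_erase_of_mem hx]; omega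
      simp only [rankProb_cons, mul_assoc]
      rw [← Finset.mul_sum]
      have hw : winProb θ S x = θ x / ∑ y ∈ S, θ y := by simp [winProb, hx]
      rw [hw]
      congr 1
      split_ifs with h1 h2
      · subst h1
        rw [← sum_rankProb hθ m (S.erase x) hc.ge]
        refine Finset.sum_congr rfl fun σ _ => ?_
        by_cases h0 : rankProb θ (S.erase x) σ = 0
        · simp [h0]
        · have hmem : j ∈ univ.image σ := by
            rw [image_eq_of_rankProb_ne_zero h0 hc]
            exact mem_erase.2 ⟨hij.symm, hj⟩
          obtain ⟨b, _, hb⟩ := mem_image.1 hmem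
          rw [breakRank_cons_self σ ⟨b, hb⟩]
          simp
      · subst h2
        refine Finset.sum_eq_zero fun σ _ => ?_
        by_cases h0 : rankProb θ (S.erase x) σ = 0
        · simp [h0]
        · rw [breakRank_cons_of_ne σ x h1, breakRank_of_notMem h0 (by simp)]
          simp
      · rw [← ih (S.erase x) hc (mem_erase.2 ⟨fun e => h1 e.symm, hi⟩)
          (mem_erase.2 ⟨fun e => h2 e.symm, hj⟩)]
        exact Finset.sum_congr rfl fun σ _ => by rw [breakRank_cons_of_ne σ j h1]
    rw [← (Fin.consEquiv (fun _ => Fin n)).sum_comp, Fintype.sum_prod_type]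
    change ∑ x, ∑ σ : Fin m → Fin n, rankProb θ S (Fin.cons x σ : Fin (m + 1) → Fin n)
        * (breakRank (Fin.cons x σ : Fin (m + 1) → Fin n) i j : ℝ) = _
    rw [← Finset.sum_subset (Finset.subset_univ S) (fun x _ hx => by
      refine Finset.sum_eq_zero fun σ _ => ?_
      rw [rankProb_cons]
      simp [winProb, hx])]
    rw [Finset.sum_congr rfl hsum]
    have hp : pref θ i j * (θ i + θ j) = θ i :=
      div_mul_cancel₀ _ (add_pos (hθ i) (hθ j)).ne'
    have hsplit : ∀ f : Fin n → ℝ, ∑ x ∈ S, f x = f i + (f j + ∑ x ∈ (S.erase i).erase j, f x) := by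
      intro f
      rw [Finset.add_sum_erase (S.erase i) f (mem_erase.2 ⟨hij.symm, hj⟩),
        Finset.add_sum_erase S f hi]
    have hrest : ∑ x ∈ (S.erase i).erase j, (θ x / ∑ y ∈ S, θ y) *
        (if x = i then 1 else if x = j then 0 else pref θ i j)
        = (∑ x ∈ (S.erase i).erase j, θ x) / (∑ y ∈ S, θ y) * pref θ i j := by
      rw [Finset.sum_div, Finset.sum_mul]
      refine Finset.sum_congr rfl fun x hx => ?_
      have h1 := mem_erase.1 hx
      have h2 := mem_erase.1 h1.2
      rw [if_neg h2.1, if_neg h1.1]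
    rw [hsplit fun x => (θ x / ∑ y ∈ S, θ y) *
        (if x = i then 1 else if x = j then 0 else pref θ i j), hrest]
    have hθs := hsplit θ
    simp only [if_true, if_neg hij.symm]
    field_simp
    rw [hθs]
    linear_combination -hp

/-- The expectation of a function of the outcome of the comparison of two played items. -/
theorem sum_rankProb_mul_outcome {n m : ℕ} {θ : Fin n → ℝ} (hθ : ∀ i, 0 < θ i)
    {S : Finset (Fin n)} (hS : S.card = m) {i j : Fin n} (hij : i ≠ j) (hi : i ∈ S) (hj : j ∈ S)
    (f : ℕ → ℕ → ℝ) :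
    ∑ σ : Fin m → Fin n, rankProb θ S σ * f (breakRank σ i j) (breakRank σ j i)
      = pref θ i j * f 1 0 + pref θ j i * f 0 1 := by
  rw [← sum_rankProb_mul_breakRank hθ hij m S hS hi hj,
    ← sum_rankProb_mul_breakRank hθ hij.symm m S hS hj hi, Finset.sum_mul, Finset.sum_mul,
    ← Finset.sum_add_distrib]
  refine Finset.sum_congr rfl fun σ _ => ?_
  by_cases h0 : rankProb θ S σ = 0
  · simp [h0]
  · rcases breakRank_dichotomy h0 hS hij hi hj with h | h <;> simp [h.1, h.2]

theorem pref_pos {n : ℕ} {θ : Fin n → ℝ} (hθ : ∀ i, 0 < θ i) (i j : Fin n) : 0 < pref θ i j :=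
  div_pos (hθ i) (add_pos (hθ i) (hθ j))

theorem pref_add_pref {n : ℕ} {θ : Fin n → ℝ} (hθ : ∀ i, 0 < θ i) (i j : Fin n) :
    pref θ i j + pref θ j i = 1 := by
  have := (add_pos (hθ i) (hθ j)).ne'
  unfold pref
  rw [add_comm (θ j), ← add_div, div_self this]

theorem pref_lt_one {n : ℕ} {θ : Fin n → ℝ} (hθ : ∀ i, 0 < θ i) (i j : Fin n) :
    pref θ i j < 1 := by
  have := pref_add_pref hθ i j
  have := pref_pos hθ j i
  linarith

/-! ### The law of the history as a product of transition probabilities -/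

theorem law_succ_apply {n k : ℕ} {θ : Fin n → ℝ} (hθ : ∀ i, 0 < θ i) (hk : 1 ≤ k) (hkn : k ≤ n)
    (α : ℝ) (u₀ : EReal) (τ : HistRule n k) (T : ℕ) (h : Fin T → Fin k → Fin n)
    (σ : Fin k → Fin n) :
    (law hθ hk hkn α u₀ τ (T + 1) (Fin.snoc h σ : Fin (T + 1) → Fin k → Fin n)).toReal
      = (law hθ hk hkn α u₀ τ T h).toReal * rankProb θ (played α u₀ τ T h) σ := by
  rw [law, PMF.bind_apply, tsum_eq_single h]
  · rw [ENNReal.toReal_mul]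
    congr 1
    rw [PMF.map_apply, tsum_eq_single σ]
    · rw [if_pos rfl, rankPMF, PMF.ofFintype_apply, ENNReal.toReal_ofReal (rankProb_nonneg hθ _ _)]
    · intro σ' hσ'
      rw [if_neg]
      intro e
      exact hσ' (by simpa using (congrFun e (Fin.last T)).symm)
  · intro h' hh'
    rw [PMF.map_apply]
    rw [ENNReal.tsum_eq_zero.2, mul_zero]
    intro σ'
    rw [if_neg]
    intro e
    exact hh' (by simpa using (congrArg Fin.init e).symm)

/-- Expectation of a function of the history of the first `T` rounds. -/
def expect {n k : ℕ} {θ : Fin n → ℝ} (hθ : ∀ i, 0 < θ i) (hk : 1 ≤ k) (hkn : k ≤ n) (α : ℝ)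
    (u₀ : EReal) (τ : HistRule n k) (T : ℕ) (f : (Fin T → Fin k → Fin n) → ℝ) : ℝ :=
  ∑ h, (law hθ hk hkn α u₀ τ T h).toReal * f h

section Expect

variable {n k : ℕ} {θ : Fin n → ℝ} (hθ : ∀ i, 0 < θ i) (hk : 1 ≤ k) (hkn : k ≤ n) (α : ℝ)
  (u₀ : EReal) (τ : HistRule n k)

/-- Conditioning on the history before the last round. -/
theorem expect_succ (T : ℕ) (f : (Fin (T + 1) → Fin k → Fin n) → ℝ) :
    expect hθ hk hkn α u₀ τ (T + 1) f = expect hθ hk hkn α u₀ τ T fun h =>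
      ∑ σ, rankProb θ (played α u₀ τ T h) σ * f (Fin.snoc h σ : Fin (T + 1) → Fin k → Fin n) := by
  unfold expect
  rw [← (Fin.snocEquiv (fun _ => Fin k → Fin n)).sum_comp, Fintype.sum_prod_type, Finset.sum_comm]
  refine Finset.sum_congr rfl fun h _ => ?_
  rw [Finset.mul_sum]
  refine Finset.sum_congr rfl fun σ _ => ?_
  change (law hθ hk hkn α u₀ τ (T + 1) (Fin.snoc h σ : Fin (T + 1) → Fin k → Fin n)).toReal
    * f (Fin.snoc h σ : Fin (T + 1) → Fin k → Fin n) = _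
  rw [law_succ_apply]
  ring

theorem expect_zero (f : (Fin 0 → Fin k → Fin n) → ℝ) :
    expect hθ hk hkn α u₀ τ 0 f = f Fin.elim0 := by
  unfold expect
  rw [Fintype.sum_unique]
  have : (default : Fin 0 → Fin k → Fin n) = Fin.elim0 := Subsingleton.elim _ _
  rw [this, law, PMF.pure_apply, if_pos rfl]
  simp

theorem expect_mono {T : ℕ} {f g : (Fin T → Fin k → Fin n) → ℝ}
    (hfg : ∀ h, law hθ hk hkn α u₀ τ T h ≠ 0 → f h ≤ g h) :
    expect hθ hk hkn α u₀ τ T f ≤ expect hθ hk hkn α u₀ τ T g := by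
  refine Finset.sum_le_sum fun h _ => ?_
  by_cases h0 : law hθ hk hkn α u₀ τ T h = 0
  · simp [h0]
  · exact mul_le_mul_of_nonneg_left (hfg h h0) ENNReal.toReal_nonneg

theorem expect_const (T : ℕ) (c : ℝ) : expect hθ hk hkn α u₀ τ T (fun _ => c) = c := by
  unfold expect
  rw [← Finset.sum_mul, ← ENNReal.toReal_sum fun h _ => PMF.apply_ne_top _ h]
  have := PMF.tsum_coe (law hθ hk hkn α u₀ τ T)
  rw [tsum_fintype] at this
  rw [this]
  simp

theorem expect_add (T : ℕ) (f g : (Fin T → Fin k → Fin n) → ℝ) :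
    expect hθ hk hkn α u₀ τ T (fun h => f h + g h)
      = expect hθ hk hkn α u₀ τ T f + expect hθ hk hkn α u₀ τ T g := by
  simp only [expect, mul_add, Finset.sum_add_distrib]

theorem expect_const_mul (T : ℕ) (c : ℝ) (f : (Fin T → Fin k → Fin n) → ℝ) :
    expect hθ hk hkn α u₀ τ T (fun h => c * f h) = c * expect hθ hk hkn α u₀ τ T f := by
  simp only [expect, Finset.mul_sum]
  exact Finset.sum_congr rfl fun h _ => by ring

theorem expect_sum {ι : Type*} (s : Finset ι) (T : ℕ) (f : ι → (Fin T → Fin k → Fin n) → ℝ) :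
    expect hθ hk hkn α u₀ τ T (fun h => ∑ i ∈ s, f i h)
      = ∑ i ∈ s, expect hθ hk hkn α u₀ τ T (f i) := by
  simp only [expect, Finset.mul_sum]
  exact Finset.sum_comm

theorem law_snoc_ne_zero {T : ℕ} {h : Fin T → Fin k → Fin n} {σ : Fin k → Fin n}
    (h0 : law hθ hk hkn α u₀ τ (T + 1) (Fin.snoc h σ : Fin (T + 1) → Fin k → Fin n) ≠ 0) :
    law hθ hk hkn α u₀ τ T h ≠ 0 ∧ rankProb θ (played α u₀ τ T h) σ ≠ 0 := by
  have h1 : (law hθ hk hkn α u₀ τ (T + 1)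
      (Fin.snoc h σ : Fin (T + 1) → Fin k → Fin n)).toReal ≠ 0 :=
    ENNReal.toReal_ne_zero.2 ⟨h0, PMF.apply_ne_top _ _⟩
  rw [law_succ_apply] at h1
  refine ⟨fun e => h1 (by simp [e]), fun e => h1 (by simp [e])⟩

end Expect

/-! ### Concentration of the pairwise win counts -/

/-- Hoeffding's lemma for a centred Bernoulli variable. -/
theorem bernoulli_mgf_le {p : ℝ} (h0 : 0 ≤ p) (h1 : p ≤ 1) (l : ℝ) :
    p * Real.exp (l * (1 - p)) + (1 - p) * Real.exp (l * -p) ≤ Real.exp (l ^ 2 / 8) := by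
  let q : unitInterval := ⟨p, h0, h1⟩
  let μ := ProbabilityTheory.bernoulliMeasure (1 - p) (-p) q
  have hint : ∀ f : ℝ → ℝ, ∫ x, f x ∂μ = p * f (1 - p) + (1 - p) * f (-p) := by
    intro f
    change ∫ x, f x ∂(ProbabilityTheory.bernoulliMeasure (1 - p) (-p) q) = _
    rw [ProbabilityTheory.integral_bernoulliMeasure]
    simp [q]
  have hb : ∀ᵐ x ∂μ, (fun x : ℝ => x) x ∈ Set.Icc (-p) (1 - p) := by
    rw [MeasureTheory.ae_iff]
    change ProbabilityTheory.bernoulliMeasure (1 - p) (-p) q _ = 0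
    rw [ProbabilityTheory.bernoulliMeasure_apply_of_notMem_of_notMem]
    · exact measurableSet_Icc.compl
    · simp
    · simp
  have h := (ProbabilityTheory.hasSubgaussianMGF_of_mem_Icc_of_integral_eq_zero
    (μ := μ) (X := fun x : ℝ => x) (a := -p) (b := 1 - p) measurable_id.aemeasurable hb
    (by rw [hint]; ring)).mgf_le l
  rw [ProbabilityTheory.mgf, hint] at h
  refine h.trans_eq ?_
  congr 1
  simp
  ring

section Concentration

variable {n k : ℕ} {θ : Fin n → ℝ} (hθ : ∀ i, 0 < θ i) (hk : 1 ≤ k) (hkn : k ≤ n) (α : ℝ)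
  (u₀ : EReal) (τ : HistRule n k)

/-- At some time within the history, exactly `m` comparisons of `i` and `j` had been made, and
`i` had won at least `p_{ij} m + x` of them. -/
def overshoot (θ : Fin n → ℝ) (i j : Fin n) (m : ℕ) (x : ℝ) :
    (T : ℕ) → (Fin T → Fin k → Fin n) → Prop
  | 0, _ => False
  | T + 1, h => overshoot θ i j m x T (Fin.init h) ∨
      ((memory α u₀ τ (T + 1) h).W i j + (memory α u₀ τ (T + 1) h).W j i = m ∧
        pref θ i j * m + x ≤ (memory α u₀ τ (T + 1) h).W i j)

/-- The exponential weight of the state `(w, c)` of a pair with `w` wins among `c` comparisons,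
which is a supermartingale along the comparisons of the pair. -/
def expWeight (p l x : ℝ) (m w c : ℕ) : ℝ :=
  Real.exp (l * (w - p * c - x) + l ^ 2 / 8 * (m - c))

/-- The supermartingale property, which is Hoeffding's lemma. -/
theorem expWeight_step {p : ℝ} (h0 : 0 ≤ p) (h1 : p ≤ 1) (l x : ℝ) (m w c : ℕ) :
    p * expWeight p l x m (w + 1) (c + 1) + (1 - p) * expWeight p l x m w (c + 1)
      ≤ expWeight p l x m w c := by
  have h := bernoulli_mgf_le h0 h1 l
  have e1 : expWeight p l x m (w + 1) (c + 1)
      = expWeight p l x m w c * Real.exp (-(l ^ 2 / 8)) * Real.exp (l * (1 - p)) := by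
    unfold expWeight
    rw [← Real.exp_add, ← Real.exp_add]
    congr 1
    push_cast
    ring
  have e2 : expWeight p l x m w (c + 1)
      = expWeight p l x m w c * Real.exp (-(l ^ 2 / 8)) * Real.exp (l * -p) := by
    unfold expWeight
    rw [← Real.exp_add, ← Real.exp_add]
    congr 1
    push_cast
    ring
  have h2 : 0 ≤ expWeight p l x m w c * Real.exp (-(l ^ 2 / 8)) := by
    unfold expWeight; positivity
  calc _ = expWeight p l x m w c * Real.exp (-(l ^ 2 / 8)) *
        (p * Real.exp (l * (1 - p)) + (1 - p) * Real.exp (l * -p)) := by rw [e1, e2]; ring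
    _ ≤ expWeight p l x m w c * Real.exp (-(l ^ 2 / 8)) * Real.exp (l ^ 2 / 8) :=
        mul_le_mul_of_nonneg_left h h2
    _ = _ := by rw [mul_assoc, ← Real.exp_add]; simp

open Classical in
/-- A potential that dominates the indicator of an overshoot: it is the exponential weight until
`m` comparisons are made, and then the indicator itself. -/
def potential (θ : Fin n → ℝ) (i j : Fin n) (m : ℕ) (x l : ℝ) (T : ℕ)
    (h : Fin T → Fin k → Fin n) : ℝ :=
  if overshoot α u₀ τ θ i j m x T h then 1
  else if (memory α u₀ τ T h).W i j + (memory α u₀ τ T h).W j i < m then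
    expWeight (pref θ i j) l x m ((memory α u₀ τ T h).W i j)
      ((memory α u₀ τ T h).W i j + (memory α u₀ τ T h).W j i)
  else 0

theorem memory_snoc_W (T : ℕ) (h : Fin T → Fin k → Fin n) (σ : Fin k → Fin n) (i j : Fin n) :
    (memory α u₀ τ (T + 1) (Fin.snoc h σ : Fin (T + 1) → Fin k → Fin n)).W i j
      = (memory α u₀ τ T h).W i j + breakRank σ i j := by
  simp [memory]

theorem potential_le {i j : Fin n} {m : ℕ} {x l : ℝ} (hl : 0 ≤ l) {T : ℕ}
    {h : Fin T → Fin k → Fin n} {σ : Fin k → Fin n} (hno : ¬ overshoot α u₀ τ θ i j m x T h)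
    {a b : ℕ} (ha : (memory α u₀ τ T h).W i j + breakRank σ i j = a)
    (hb : (memory α u₀ τ T h).W j i + breakRank σ j i = b) :
    potential α u₀ τ θ i j m x l (T + 1) (Fin.snoc h σ : Fin (T + 1) → Fin k → Fin n)
      ≤ expWeight (pref θ i j) l x m a (a + b) := by
  unfold potential
  rw [memory_snoc_W, memory_snoc_W, ha, hb]
  split_ifs with h1 h2
  · rw [overshoot, Fin.init_snoc, memory_snoc_W, memory_snoc_W, ha, hb] at h1
    rcases h1 with h1 | ⟨h1, h2⟩
    · exact absurd h1 hno
    · unfold expWeight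
      refine Real.one_le_exp ?_
      rw [h1, sub_self, mul_zero, add_zero]
      exact mul_nonneg hl (by linarith)
  · exact le_rfl
  · exact (Real.exp_pos _).le

theorem sum_rankProb_potential_le (hθ : ∀ i, 0 < θ i) (hk : 1 ≤ k) (hkn : k ≤ n)
    {i j : Fin n} (hij : i ≠ j) {m : ℕ} (hm : 1 ≤ m) {x l : ℝ} (hl : 0 ≤ l)
    (T : ℕ) (h : Fin T → Fin k → Fin n) :
    ∑ σ, rankProb θ (played α u₀ τ T h) σ *
      potential α u₀ τ θ i j m x l (T + 1) (Fin.snoc h σ : Fin (T + 1) → Fin k → Fin n)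
      ≤ potential α u₀ τ θ i j m x l T h := by
  set S := played α u₀ τ T h with hS
  have hcard : S.card = k := card_played hk hkn α u₀ τ T h
  have hbound : ∀ c : ℝ, (∀ σ, rankProb θ S σ ≠ 0 →
      potential α u₀ τ θ i j m x l (T + 1) (Fin.snoc h σ : Fin (T + 1) → Fin k → Fin n) ≤ c) →
      ∑ σ, rankProb θ S σ *
        potential α u₀ τ θ i j m x l (T + 1) (Fin.snoc h σ : Fin (T + 1) → Fin k → Fin n) ≤ c := by
    intro c hc
    calc _ ≤ ∑ σ : Fin k → Fin n, rankProb θ S σ * c := by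
          refine Finset.sum_le_sum fun σ _ => ?_
          by_cases h0 : rankProb θ S σ = 0
          · simp [h0]
          · exact mul_le_mul_of_nonneg_left (hc σ h0) (rankProb_nonneg hθ _ _)
      _ = c := by rw [← Finset.sum_mul, sum_rankProb hθ k S hcard.ge, one_mul]
  by_cases hov : overshoot α u₀ τ θ i j m x T h
  · have e : potential α u₀ τ θ i j m x l T h = 1 := if_pos hov
    rw [e]
    refine hbound 1 fun σ _ => le_of_eq (if_pos ?_)
    rw [overshoot, Fin.init_snoc]
    exact Or.inl hov
  by_cases hlt : (memory α u₀ τ T h).W i j + (memory α u₀ τ T h).W j i < m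
  · have e : potential α u₀ τ θ i j m x l T h
        = expWeight (pref θ i j) l x m ((memory α u₀ τ T h).W i j)
          ((memory α u₀ τ T h).W i j + (memory α u₀ τ T h).W j i) := by
      unfold potential; rw [if_neg hov, if_pos hlt]
    rw [e]
    by_cases hmem : i ∈ S ∧ j ∈ S
    · have key := sum_rankProb_mul_outcome hθ hcard hij hmem.1 hmem.2
        (fun a b : ℕ => expWeight (pref θ i j) l x m ((memory α u₀ τ T h).W i j + a)
          ((memory α u₀ τ T h).W i j + a + ((memory α u₀ τ T h).W j i + b)))
      have e1 : pref θ j i = 1 - pref θ i j := by linarith [pref_add_pref hθ i j]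
      refine le_trans (Finset.sum_le_sum fun σ _ => mul_le_mul_of_nonneg_left
        (potential_le α u₀ τ hl hov rfl rfl) (rankProb_nonneg hθ _ _)) (key.trans_le ?_)
      rw [e1]
      refine le_trans (le_of_eq ?_) (expWeight_step (pref_pos hθ i j).le (pref_lt_one hθ i j).le
        l x m ((memory α u₀ τ T h).W i j)
        ((memory α u₀ τ T h).W i j + (memory α u₀ τ T h).W j i))
      simp only [add_zero]
      congr 3
      ring
    · refine hbound _ fun σ h0 => potential_le α u₀ τ hl hov ?_ ?_
      · rw [breakRank_of_notMem h0 hmem, add_zero]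
      · rw [breakRank_of_notMem h0 fun h => hmem h.symm, add_zero]
  · have e : potential α u₀ τ θ i j m x l T h = 0 := by
      unfold potential; rw [if_neg hov, if_neg hlt]
    rw [e]
    refine hbound 0 fun σ _ => le_of_eq ?_
    unfold potential
    rw [if_neg, if_neg]
    · rw [memory_snoc_W, memory_snoc_W]; omega
    · rw [overshoot, Fin.init_snoc, memory_snoc_W, memory_snoc_W]
      rintro (h1 | ⟨h1, h2⟩)
      · exact hov h1
      -- no comparison of the pair was added, so the overshoot took place before
      · have hi : breakRank σ i j = 0 := by omega
        have hj : breakRank σ j i = 0 := by omega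
        rw [hi, hj] at h1
        rw [hi] at h2
        cases T with
        | zero =>
          simp [memory] at h1
          omega
        | succ T => exact hov (Or.inr ⟨h1, h2⟩)

open Classical in
/-- Hoeffding's inequality for the first `m` comparisons of a pair, at whatever times they are
made. -/
theorem expect_overshoot_le {i j : Fin n} (hij : i ≠ j) {m : ℕ} (hm : 1 ≤ m) {x : ℝ}
    (hx : 0 ≤ x) (T : ℕ) :
    expect hθ hk hkn α u₀ τ T (fun h => if overshoot α u₀ τ θ i j m x T h then 1 else 0)
      ≤ Real.exp (-2 * x ^ 2 / m) := by
  have hm0 : (0 : ℝ) < m := by exact_mod_cast hm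
  -- the exponent `4x/m` minimizes `-l x + l² m / 8`
  set l : ℝ := 4 * x / m with hl
  have hl0 : 0 ≤ l := by positivity
  have hstep : ∀ T, expect hθ hk hkn α u₀ τ T (potential α u₀ τ θ i j m x l T)
      ≤ Real.exp (-2 * x ^ 2 / m) := by
    intro T
    induction T with
    | zero =>
      rw [expect_zero]
      unfold potential
      rw [if_neg (by simp [overshoot]), if_pos (by simp [memory]; omega)]
      unfold expWeight
      refine le_of_eq (congrArg _ ?_)
      simp only [memory, hl]
      push_cast
      field_simp
      ring
    | succ T ih =>
      rw [expect_succ]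
      exact le_trans (expect_mono hθ hk hkn α u₀ τ fun h _ =>
        sum_rankProb_potential_le α u₀ τ hθ hk hkn hij hm hl0 T h) ih
  refine le_trans (expect_mono hθ hk hkn α u₀ τ fun h _ => ?_) (hstep T)
  unfold potential
  split_ifs
  · exact le_rfl
  · exact (Real.exp_pos _).le
  · exact le_rfl

/-! ### The last round in which a confidence bound fails -/

/-- In a round at time `t` with win counts `W`, some confidence bound fails.  Equality counts as a
failure, so that valid upper bounds strictly exceed the true preferences, even for items with
equal `θ`. -/
def BoundFails (θ : Fin n → ℝ) (t : ℕ) (W : Fin n → Fin n → ℕ) : Prop :=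
  ∃ i j, i ≠ j ∧ 0 < W i j + W j i ∧
    pref θ i j * ((W i j + W j i : ℕ) : ℝ)
      + Real.sqrt (α * Real.log t * ((W i j + W j i : ℕ) : ℝ)) ≤ W i j

open Classical in
/-- The time of the last round in which a confidence bound fails, or `0` if there is none. -/
def lastFailure (θ : Fin n → ℝ) : (T : ℕ) → (Fin T → Fin k → Fin n) → ℕ
  | 0, _ => 0
  | T + 1, h => if BoundFails α θ (T + 1) (memory α u₀ τ T (Fin.init h)).W then T + 1
      else lastFailure θ T (Fin.init h)

theorem lastFailure_le (T : ℕ) (h : Fin T → Fin k → Fin n) :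
    lastFailure α u₀ τ θ T h ≤ T := by
  induction T with
  | zero => simp [lastFailure]
  | succ T ih =>
    rw [lastFailure]
    split_ifs
    · exact le_rfl
    · exact (ih _).trans (Nat.le_succ T)

theorem comparisons_le {i j : Fin n} (hij : i ≠ j) (T : ℕ) (h : Fin T → Fin k → Fin n)
    (h0 : law hθ hk hkn α u₀ τ T h ≠ 0) :
    (memory α u₀ τ T h).W i j + (memory α u₀ τ T h).W j i ≤ T := by
  induction T with
  | zero => simp [memory]
  | succ T ih =>
    rw [← Fin.snoc_init_self h] at h0 ⊢
    obtain ⟨h1, h2⟩ := law_snoc_ne_zero hθ hk hkn α u₀ τ h0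
    have h3 := ih _ h1
    rw [memory_snoc_W, memory_snoc_W]
    by_cases hmem : i ∈ played α u₀ τ T (Fin.init h) ∧ j ∈ played α u₀ τ T (Fin.init h)
    · rcases breakRank_dichotomy h2 (card_played hk hkn α u₀ τ T _) hij hmem.1 hmem.2 with h | h <;>
        rw [h.1, h.2] <;> omega
    · rw [breakRank_of_notMem h2 hmem, breakRank_of_notMem h2 fun h => hmem h.symm]
      omega

theorem exists_overshoot_of_lt_lastFailure (hα : 0 ≤ α) {c : ℕ} (hc : 1 ≤ c) (T : ℕ)
    (h : Fin T → Fin k → Fin n) (h0 : law hθ hk hkn α u₀ τ T h ≠ 0)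
    (hlt : c < lastFailure α u₀ τ θ T h) :
    ∃ i j, i ≠ j ∧ ∃ m ∈ Icc 1 T,
      overshoot α u₀ τ θ i j m (Real.sqrt (α * Real.log (max c m : ℕ) * m)) T h := by
  induction T with
  | zero => simp [lastFailure] at hlt
  | succ T ih =>
    rw [← Fin.snoc_init_self h] at h0
    obtain ⟨h1, -⟩ := law_snoc_ne_zero hθ hk hkn α u₀ τ h0
    rw [lastFailure] at hlt
    split_ifs at hlt with hf
    · obtain ⟨i, j, hij, hpos, hle⟩ := hf
      have hm := comparisons_le hθ hk hkn α u₀ τ hij T (Fin.init h) h1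
      set M := memory α u₀ τ T (Fin.init h) with hM
      refine ⟨i, j, hij, M.W i j + M.W j i, mem_Icc.2 ⟨hpos, by omega⟩, Or.inl ?_⟩
      cases T with
      | zero => omega
      | succ T =>
        refine Or.inr ⟨rfl, le_trans ?_ hle⟩
        have hpos : (0 : ℝ) < (max c (M.W i j + M.W j i) : ℕ) := by
          exact_mod_cast lt_of_lt_of_le hc (le_max_left _ _)
        have hle : max c (M.W i j + M.W j i) ≤ T + 1 + 1 := max_le (by omega) (by omega)
        gcongr
    · obtain ⟨i, j, hij, m, hm, hov⟩ := ih _ h1 hlt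
      exact ⟨i, j, hij, m, mem_Icc.2 ⟨(mem_Icc.1 hm).1, (mem_Icc.1 hm).2.trans (Nat.le_succ T)⟩,
        Or.inl hov⟩

end Concentration

/-- Comparison of the tail of `∑ m⁻ˢ` with the integral of `x⁻ˢ`. -/
theorem sum_Ioc_rpow_neg_le {s : ℝ} (hs : 1 < s) {c : ℕ} (hc : 1 ≤ c) (T : ℕ) :
    ∑ m ∈ Ioc c T, (m : ℝ) ^ (-s) ≤ (c : ℝ) ^ (1 - s) / (s - 1) := by
  have hs1 : 0 < s - 1 := by linarith
  have hc0 : (0 : ℝ) < c := by exact_mod_cast hc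
  rcases le_or_gt T c with hT | hT
  · rw [Finset.Ioc_eq_empty (by omega), Finset.sum_empty]
    positivity
  suffices h : ∀ T, c ≤ T → ∑ m ∈ Ioc c T, (m : ℝ) ^ (-s)
      ≤ ((c : ℝ) ^ (1 - s) - (T : ℝ) ^ (1 - s)) / (s - 1) by
    refine (h T hT.le).trans ?_
    gcongr
    have : 0 ≤ (T : ℝ) ^ (1 - s) := by positivity
    linarith
  intro T hT
  induction T, hT using Nat.le_induction with
  | base => simp
  | succ T hT ih =>
    have hT0 : (0 : ℝ) < T := by exact_mod_cast (by omega : 0 < T)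
    have hT1 : (0 : ℝ) < T + 1 := by linarith
    rw [← Finset.insert_Ioc_right_eq_Ioc_add_one hT, Finset.sum_insert (by simp)]
    have key : (s - 1) * ((T + 1 : ℕ) : ℝ) ^ (-s)
        ≤ (T : ℝ) ^ (1 - s) - ((T + 1 : ℕ) : ℝ) ^ (1 - s) := by
      push_cast
      have hlog : 1 / ((T : ℝ) + 1) ≤ Real.log ((T + 1) / T) := by
        have h := Real.one_sub_inv_le_log_of_pos (x := ((T : ℝ) + 1) / T) (by positivity)
        refine le_trans (le_of_eq ?_) h
        field_simp
        ring
      have h1 : 1 + (s - 1) / (T + 1) ≤ (((T : ℝ) + 1) / T) ^ (s - 1) := by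
        rw [Real.rpow_def_of_pos (by positivity)]
        have h2 := Real.add_one_le_exp (Real.log (((T : ℝ) + 1) / T) * (s - 1))
        have h3 := mul_le_mul_of_nonneg_right hlog hs1.le
        rw [one_div_mul_eq_div] at h3
        linarith
      have e1 : (T : ℝ) ^ (1 - s) = ((T : ℝ) + 1) ^ (1 - s) * (((T : ℝ) + 1) / T) ^ (s - 1) := by
        rw [Real.div_rpow hT1.le hT0.le, ← mul_div_assoc, ← Real.rpow_add hT1]
        rw [show 1 - s + (s - 1) = 0 by ring, Real.rpow_zero, one_div, ← Real.rpow_neg hT0.le]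
        congr 1; ring
      have e2 : ((T : ℝ) + 1) ^ (-s) = ((T : ℝ) + 1) ^ (1 - s) * (1 / (T + 1)) := by
        rw [show -s = 1 - s - 1 by ring, Real.rpow_sub_one hT1.ne']
        ring
      rw [e1, e2]
      have h4 : 0 ≤ ((T : ℝ) + 1) ^ (1 - s) := by positivity
      have h5 := mul_le_mul_of_nonneg_left h1 h4
      have e3 : (s - 1) * (((T : ℝ) + 1) ^ (1 - s) * (1 / (T + 1)))
        = ((T : ℝ) + 1) ^ (1 - s) * ((s - 1) / (T + 1)) := by ring
      rw [e3]
      linarith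
    rw [le_div_iff₀ hs1] at ih ⊢
    push_cast at key ih ⊢
    linarith

section Expectation

variable {n k : ℕ} {θ : Fin n → ℝ} (hθ : ∀ i, 0 < θ i) (hk : 1 ≤ k) (hkn : k ≤ n) (α : ℝ)
  (u₀ : EReal) (τ : HistRule n k)

theorem prob_lt_lastFailure_le (hα : 1 < α) {c : ℕ} (hc : 1 ≤ c) (T : ℕ) :
    expect hθ hk hkn α u₀ τ T (fun h => if c < lastFailure α u₀ τ θ T h then 1 else 0)
      ≤ 2 * α * (n : ℝ) ^ 2 / (2 * α - 1) * (c : ℝ) ^ (-(2 * α - 1)) := by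
  classical
  have hc0 : (0 : ℝ) < c := by exact_mod_cast hc
  have h2α : 0 < 2 * α - 1 := by linarith
  set x : ℕ → ℝ := fun m => Real.sqrt (α * Real.log (max c m : ℕ) * m) with hx
  have hone : ∀ m ∈ Icc 1 T, Real.exp (-2 * x m ^ 2 / m) = ((max c m : ℕ) : ℝ) ^ (-(2 * α)) := by
    intro m hm
    have hm0 : (0 : ℝ) < m := by exact_mod_cast (mem_Icc.1 hm).1
    have hmax : (1 : ℝ) ≤ (max c m : ℕ) := by exact_mod_cast hc.trans (le_max_left _ _)
    have hlog := Real.log_nonneg hmax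
    rw [hx]
    simp only
    rw [Real.sq_sqrt (by positivity), Real.rpow_def_of_pos (by linarith)]
    congr 1
    field_simp
  have hsum : ∑ m ∈ Icc 1 T, ((max c m : ℕ) : ℝ) ^ (-(2 * α))
      ≤ 2 * α / (2 * α - 1) * (c : ℝ) ^ (-(2 * α - 1)) := by
    have h1 : ∑ m ∈ Icc 1 T, ((max c m : ℕ) : ℝ) ^ (-(2 * α))
        ≤ ∑ m ∈ Ioc 0 c, (c : ℝ) ^ (-(2 * α)) + ∑ m ∈ Ioc c T, (m : ℝ) ^ (-(2 * α)) := by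
      have e1 : ∑ m ∈ Ioc 0 c, (c : ℝ) ^ (-(2 * α))
          = ∑ m ∈ Ioc 0 c, ((max c m : ℕ) : ℝ) ^ (-(2 * α)) :=
        Finset.sum_congr rfl fun m hm => by rw [max_eq_left (mem_Ioc.1 hm).2]
      have e2 : ∑ m ∈ Ioc c T, (m : ℝ) ^ (-(2 * α))
          = ∑ m ∈ Ioc c T, ((max c m : ℕ) : ℝ) ^ (-(2 * α)) :=
        Finset.sum_congr rfl fun m hm => by rw [max_eq_right (mem_Ioc.1 hm).1.le]
      rw [e1, e2, ← Finset.sum_union (by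
        rw [Finset.disjoint_left]
        intro a ha hb
        exact absurd (mem_Ioc.1 ha).2 (not_le.2 (mem_Ioc.1 hb).1))]
      refine Finset.sum_le_sum_of_subset_of_nonneg ?_ fun m _ _ => by positivity
      intro m hm
      rw [mem_Icc] at hm
      rw [mem_union, mem_Ioc, mem_Ioc]
      omega
    have h2 := sum_Ioc_rpow_neg_le (s := 2 * α) (by linarith) hc T
    rw [Finset.sum_const, Nat.card_Ioc, Nat.sub_zero, nsmul_eq_mul] at h1
    have e1 : (c : ℝ) * (c : ℝ) ^ (-(2 * α)) = (c : ℝ) ^ (-(2 * α - 1)) := by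
      rw [show -(2 * α) = -(2 * α - 1) - 1 by ring, Real.rpow_sub_one hc0.ne']
      field_simp
    rw [e1] at h1
    rw [show (1 - 2 * α) = -(2 * α - 1) by ring] at h2
    refine (h1.trans (add_le_add_right h2 _)).trans (le_of_eq ?_)
    field_simp
    ring
  calc expect hθ hk hkn α u₀ τ T (fun h => if c < lastFailure α u₀ τ θ T h then 1 else 0)
      ≤ expect hθ hk hkn α u₀ τ T (fun h => ∑ p ∈ (univ : Finset (Fin n)).offDiag,
          ∑ m ∈ Icc 1 T, if overshoot α u₀ τ θ p.1 p.2 m (x m) T h then (1 : ℝ) else 0) := by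
        refine expect_mono hθ hk hkn α u₀ τ fun h h0 => ?_
        have hnn : ∀ p ∈ (univ : Finset (Fin n)).offDiag, 0 ≤ ∑ m ∈ Icc 1 T,
            if overshoot α u₀ τ θ p.1 p.2 m (x m) T h then (1 : ℝ) else 0 :=
          fun p _ => Finset.sum_nonneg fun m _ => by split_ifs <;> norm_num
        split_ifs with hlt
        · obtain ⟨i, j, hij, m, hm, hov⟩ :=
            exists_overshoot_of_lt_lastFailure hθ hk hkn α u₀ τ (by linarith) hc T h h0 hlt
          refine le_trans ?_ (Finset.single_le_sum hnn (mem_offDiag.2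
            (⟨mem_univ i, mem_univ j, hij⟩ :
              (i, j).1 ∈ univ ∧ (i, j).2 ∈ univ ∧ (i, j).1 ≠ (i, j).2)))
          refine le_trans ?_ (Finset.single_le_sum
            (fun m _ => by split_ifs <;> norm_num) hm)
          rw [if_pos hov]
        · exact Finset.sum_nonneg hnn
    _ = ∑ p ∈ (univ : Finset (Fin n)).offDiag, ∑ m ∈ Icc 1 T, expect hθ hk hkn α u₀ τ T
          (fun h => if overshoot α u₀ τ θ p.1 p.2 m (x m) T h then (1 : ℝ) else 0) := by
        rw [expect_sum]
        exact Finset.sum_congr rfl fun p _ => expect_sum hθ hk hkn α u₀ τ _ T _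
    _ ≤ ∑ p ∈ (univ : Finset (Fin n)).offDiag,
          (2 * α / (2 * α - 1) * (c : ℝ) ^ (-(2 * α - 1))) := by
        refine Finset.sum_le_sum fun p hp => le_trans (Finset.sum_le_sum fun m hm => ?_) hsum
        rw [← hone m hm]
        exact expect_overshoot_le hθ hk hkn α u₀ τ (mem_offDiag.1 hp).2.2 (mem_Icc.1 hm).1
          (Real.sqrt_nonneg _) T
    _ ≤ (n : ℝ) ^ 2 * (2 * α / (2 * α - 1) * (c : ℝ) ^ (-(2 * α - 1))) := by
        rw [Finset.sum_const, nsmul_eq_mul]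
        refine mul_le_mul_of_nonneg_right ?_ (by positivity)
        rw [offDiag_card, Finset.card_univ, Fintype.card_fin, sq]
        exact_mod_cast Nat.sub_le _ _
    _ = _ := by ring

/-- The bound is the integral of `min 1 (K x⁻ˢ)`, with `s = 2α - 1` and `K = 2αn²/s`, up to
rounding. -/
theorem expect_lastFailure_le (hα : 1 < α) (T : ℕ) :
    expect hθ hk hkn α u₀ τ T (fun h => (lastFailure α u₀ τ θ T h : ℝ))
      ≤ (2 * α * (n : ℝ) ^ 2 / (2 * α - 1)) ^ (1 / (2 * α - 1)) * ((2 * α - 1) / (2 * α - 2))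
        + 2 := by
  classical
  have hn : (1 : ℝ) ≤ n := by exact_mod_cast hk.trans hkn
  have hs : 1 < 2 * α - 1 := by linarith
  set s := 2 * α - 1 with hsdef
  set K := 2 * α * (n : ℝ) ^ 2 / s with hK
  have hK1 : 1 ≤ K := by
    rw [hK, le_div_iff₀ (by linarith)]
    nlinarith [mul_le_mul hn hn zero_le_one (by linarith)]
  have hK0 : 0 < K := by linarith
  set x := K ^ (1 / s) with hx
  have hx1 : 1 ≤ x := Real.one_le_rpow hK1 (by positivity)
  have hxs : K * x ^ (1 - s) = x := by
    have e : K = x ^ s := by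
      rw [hx, ← Real.rpow_mul hK0.le, one_div_mul_cancel (by linarith), Real.rpow_one]
    rw [e, ← Real.rpow_add (by linarith)]
    simp
  have hone : ∀ c, expect hθ hk hkn α u₀ τ T
      (fun h => if c < lastFailure α u₀ τ θ T h then (1 : ℝ) else 0) ≤ 1 := by
    intro c
    refine (expect_mono hθ hk hkn α u₀ τ (g := fun _ => 1) fun h _ => ?_).trans_eq
      (expect_const hθ hk hkn α u₀ τ T 1)
    split_ifs <;> norm_num
  set c := ⌊x⌋₊ + 1 with hc
  have hcx : x ≤ c := by rw [hc]; push_cast; exact (Nat.lt_floor_add_one x).le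
  have hcx' : (c : ℝ) ≤ x + 1 := by
    rw [hc]; push_cast; linarith [Nat.floor_le (show 0 ≤ x by linarith)]
  calc expect hθ hk hkn α u₀ τ T (fun h => (lastFailure α u₀ τ θ T h : ℝ))
      = ∑ m ∈ range T, expect hθ hk hkn α u₀ τ T
          (fun h => if m < lastFailure α u₀ τ θ T h then (1 : ℝ) else 0) := by
        rw [← expect_sum]
        congr 1
        funext h
        rw [Finset.sum_boole]
        congr 1
        have e : {m ∈ range T | m < lastFailure α u₀ τ θ T h}
            = range (lastFailure α u₀ τ θ T h) := by
          ext m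
          simp only [mem_filter, mem_range]
          have := lastFailure_le (θ := θ) α u₀ τ T h
          omega
        rw [e, card_range]
    _ ≤ ∑ m ∈ range (c + 1), (1 : ℝ) + ∑ m ∈ Ioc c T, K * (m : ℝ) ^ (-s) := by
        have hsub : range T ⊆ range (c + 1) ∪ Ioc c T := by
          intro m hm
          rw [mem_range] at hm
          rw [mem_union, mem_range, mem_Ioc]
          omega
        have hnn : ∀ m, 0 ≤ expect hθ hk hkn α u₀ τ T
            (fun h => if m < lastFailure α u₀ τ θ T h then (1 : ℝ) else 0) := by
          intro m
          refine (expect_const hθ hk hkn α u₀ τ T 0).symm.trans_le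
            (expect_mono hθ hk hkn α u₀ τ fun h _ => ?_)
          split_ifs <;> norm_num
        refine (Finset.sum_le_sum_of_subset_of_nonneg hsub fun m _ _ => hnn m).trans ?_
        rw [Finset.sum_union (by
          rw [Finset.disjoint_left]
          intro a ha hb
          rw [mem_range] at ha
          rw [mem_Ioc] at hb
          omega)]
        refine add_le_add (Finset.sum_le_sum fun m _ => hone m)
          (Finset.sum_le_sum fun m hm => ?_)
        exact prob_lt_lastFailure_le hθ hk hkn α u₀ τ hα (by rw [mem_Ioc] at hm; omega) T
    _ ≤ (x + 2) + x / (s - 1) := by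
        refine add_le_add ?_ ?_
        · rw [Finset.sum_const, card_range, nsmul_eq_mul]
          push_cast
          linarith
        · rw [← Finset.mul_sum]
          have h1 := sum_Ioc_rpow_neg_le hs (c := c) (by omega) T
          have h2 : (c : ℝ) ^ (1 - s) ≤ x ^ (1 - s) :=
            Real.rpow_le_rpow_of_nonpos (by linarith) hcx (by linarith)
          calc _ ≤ K * ((c : ℝ) ^ (1 - s) / (s - 1)) := mul_le_mul_of_nonneg_left h1 hK0.le
            _ ≤ K * (x ^ (1 - s) / (s - 1)) := by
                refine mul_le_mul_of_nonneg_left ?_ hK0.le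
                exact div_le_div_of_nonneg_right h2 (by linarith)
            _ = x / (s - 1) := by rw [← mul_div_assoc, hxs]
    _ = x * (s / (2 * α - 2)) + 2 := by
        have h1 : 2 * α - 2 = s - 1 := by rw [hsdef]; ring
        have h2 : s - 1 ≠ 0 := by linarith
        rw [h1]
        field_simp
        ring

end Expectation

/-! ### Pairwise preferences -/

section Pref

variable {n : ℕ} {θ : Fin n → ℝ} (hθ : ∀ i, 0 < θ i)
include hθ

theorem pref_lt_pref {a b : Fin n} (x : Fin n) (h : θ a < θ b) : pref θ a x < pref θ b x := by
  unfold pref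
  rw [div_lt_div_iff₀ (add_pos (hθ a) (hθ x)) (add_pos (hθ b) (hθ x))]
  nlinarith [hθ a, hθ b, hθ x]

theorem pref_le_pref_right (a : Fin n) {x y : Fin n} (h : θ x ≤ θ y) :
    pref θ a y ≤ pref θ a x := by
  unfold pref
  exact div_le_div_of_nonneg_left (hθ a).le (add_pos (hθ a) (hθ x)) (by linarith)

theorem half_lt_pref {a x : Fin n} (h : θ x < θ a) : 1 / 2 < pref θ a x := by
  unfold pref
  rw [div_lt_div_iff₀ two_pos (add_pos (hθ a) (hθ x))]
  linarith

theorem half_le_pref {a x : Fin n} (h : θ x ≤ θ a) : 1 / 2 ≤ pref θ a x := by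
  unfold pref
  rw [div_le_div_iff₀ two_pos (add_pos (hθ a) (hθ x))]
  linarith

end Pref

/-! ### Consequences of valid confidence bounds -/

theorem le_mul_of_mul_sq_le {α m d L D : ℝ} (hd : 0 < d) (hL : 0 ≤ L)
    (h : m * d ^ 2 ≤ 4 * α * L) (hD : 4 * α / d ^ 2 ≤ D) : m ≤ D * L := by
  have h1 : m ≤ 4 * α / d ^ 2 * L := by
    rw [div_mul_eq_mul_div, le_div_iff₀ (by positivity)]
    exact h
  exact h1.trans (mul_le_mul_of_nonneg_right hD hL)

/-- The set `R`, played at time `t`, contains a pair `i, j` that has been compared at most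
`D^g_{ij} ln t` times, for one of the `k` best items `g`, which is better than `j`. -/
def Uncertain {n : ℕ} (α : ℝ) (θ : Fin n → ℝ) (k t : ℕ) (W : Fin n → Fin n → ℕ)
    (R : Finset (Fin n)) : Prop :=
  ∃ g i j : Fin n, g.val < k ∧ θ j < θ g ∧ i ≠ j ∧ i ∈ R ∧ j ∈ R ∧
    ((W i j + W j i : ℕ) : ℝ) ≤ pairConst α θ g i j * Real.log t

section Bounds

variable {n : ℕ} {θ : Fin n → ℝ} (hθ : ∀ i, 0 < θ i) {α : ℝ} (hα : 0 < α) {u₀ : EReal}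
  (hu₀ : 1 ≤ u₀) {t : ℕ} {W : Fin n → Fin n → ℕ} (hgood : ¬ BoundFails α θ t W)

theorem sqrt_div_eq {L m : ℝ} (hm : 0 < m) : Real.sqrt (L / m) = Real.sqrt (L * m) / m := by
  rw [show L / m = L * m / m ^ 2 by field_simp, Real.sqrt_div' _ (sq_nonneg m),
    Real.sqrt_sq hm.le]

include hgood in
theorem winRate_lt {i j : Fin n} (hij : i ≠ j) (hpos : 0 < W i j + W j i) :
    (W i j : ℝ) / ((W i j : ℝ) + W j i)
      < pref θ i j + Real.sqrt (α * Real.log t / ((W i j : ℝ) + W j i)) := by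
  have hm : (0 : ℝ) < (W i j : ℝ) + W j i := by exact_mod_cast hpos
  by_contra hcon
  rw [not_lt, sqrt_div_eq hm, le_div_iff₀ hm, add_mul, div_mul_cancel₀ _ hm.ne'] at hcon
  exact hgood ⟨i, j, hij, hpos, by push_cast; exact hcon⟩

include hθ hu₀ hgood in
theorem pref_lt_ucb {i j : Fin n} (hij : i ≠ j) :
    (pref θ i j : EReal) < ucb α u₀ t W i j := by
  unfold ucb
  rw [if_neg hij]
  split_ifs with h0
  · refine lt_of_lt_of_le ?_ hu₀
    rw [← EReal.coe_one, EReal.coe_lt_coe_iff]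
    exact pref_lt_one hθ i j
  · rw [EReal.coe_lt_coe_iff]
    have h1 := winRate_lt hgood hij.symm (by omega)
    have hm : (0 : ℝ) < (W i j : ℝ) + W j i := by exact_mod_cast Nat.pos_of_ne_zero h0
    rw [add_comm (W j i : ℝ)] at h1
    have h2 : (W i j : ℝ) / ((W i j : ℝ) + W j i) + W j i / ((W i j : ℝ) + W j i) = 1 := by
      rw [← add_div, div_self hm.ne']
    have h3 := pref_add_pref hθ i j
    linarith

include hα hgood in
/-- An upper confidence bound well above the true preference betrays few comparisons. -/
theorem comparisons_mul_sq_le {x y : Fin n} (hxy : x ≠ y) {q : ℝ} (hq : pref θ x y < q)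
    (hle : (q : EReal) ≤ ucb α u₀ t W x y) :
    ((W x y + W y x : ℕ) : ℝ) * (q - pref θ x y) ^ 2 ≤ 4 * α * Real.log t := by
  have hL : 0 ≤ α * Real.log t := mul_nonneg hα.le (Real.log_natCast_nonneg t)
  unfold ucb at hle
  rw [if_neg hxy] at hle
  split_ifs at hle with h0
  · rw [h0]; push_cast; linarith
  · rw [EReal.coe_le_coe_iff] at hle
    have hm : (0 : ℝ) < (W x y : ℝ) + W y x := by exact_mod_cast Nat.pos_of_ne_zero h0
    have h1 := winRate_lt hgood hxy (Nat.pos_of_ne_zero h0)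
    have h2 : (q - pref θ x y) ^ 2
        ≤ (2 * Real.sqrt (α * Real.log t / ((W x y : ℝ) + W y x))) ^ 2 :=
      pow_le_pow_left₀ (by linarith) (by linarith) 2
    rw [mul_pow, Real.sq_sqrt (by positivity)] at h2
    push_cast
    calc _ ≤ ((W x y : ℝ) + W y x) * (2 ^ 2 * (α * Real.log t / ((W x y : ℝ) + W y x))) :=
          mul_le_mul_of_nonneg_left h2 hm.le
      _ = _ := by field_simp; ring

include hα in
/-- If both upper confidence bounds of a pair are large, then it was compared rarely. -/
theorem comparisons_mul_sq_le_of_both {x y : Fin n} (hxy : x ≠ y) {q : ℝ} (hq : 1 / 2 < q)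
    (hle : (q : EReal) ≤ ucb α u₀ t W x y)
    (hle' : ((1 / 2 : ℝ) : EReal) < ucb α u₀ t W y x) :
    ((W x y + W y x : ℕ) : ℝ) * (q - 1 / 2) ^ 2 ≤ 4 * α * Real.log t := by
  have hL : 0 ≤ α * Real.log t := mul_nonneg hα.le (Real.log_natCast_nonneg t)
  unfold ucb at hle hle'
  rw [if_neg hxy] at hle
  rw [if_neg hxy.symm, add_comm (W y x), add_comm (W y x : ℝ)] at hle'
  split_ifs at hle with h0
  · rw [h0]; push_cast; linarith
  · rw [if_neg h0] at hle'
    rw [EReal.coe_le_coe_iff] at hle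
    rw [EReal.coe_lt_coe_iff] at hle'
    have hm : (0 : ℝ) < (W x y : ℝ) + W y x := by exact_mod_cast Nat.pos_of_ne_zero h0
    have h1 : (W x y : ℝ) / ((W x y : ℝ) + W y x) + W y x / ((W x y : ℝ) + W y x) = 1 := by
      rw [← add_div, div_self hm.ne']
    have h2 : (q - 1 / 2) ^ 2
        ≤ (2 * Real.sqrt (α * Real.log t / ((W x y : ℝ) + W y x))) ^ 2 :=
      pow_le_pow_left₀ (by linarith) (by linarith) 2
    rw [mul_pow, Real.sq_sqrt (by positivity)] at h2
    push_cast
    calc _ ≤ ((W x y : ℝ) + W y x) * (2 ^ 2 * (α * Real.log t / ((W x y : ℝ) + W y x))) :=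
          mul_le_mul_of_nonneg_left h2 hm.le
      _ = _ := by field_simp; ring

theorem pref_congr {a b x y : Fin n} (h : θ a = θ b) (h' : θ x = θ y) :
    pref θ a x = pref θ b y := by
  unfold pref; rw [h, h']

include hθ hα hgood in
/-- A worse item `j` that could still beat `i`, where `i` is as good as `g`. -/
theorem uncertain_of_eq {k : ℕ} {R : Finset (Fin n)} {g i j : Fin n} (hg : g.val < k)
    (hi : θ i = θ g) (hj : θ j < θ g) (hiR : i ∈ R) (hjR : j ∈ R)
    (hle : ((1 / 2 : ℝ) : EReal) < ucb α u₀ t W j i) : Uncertain α θ k t W R := by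
  have hij : i ≠ j := fun e => hj.ne (by rw [← e, hi])
  have e1 : 1 / 2 - pref θ j i = pref θ g j - 1 / 2 := by
    rw [← pref_congr hi rfl]
    linarith [pref_add_pref hθ i j]
  have h1 := half_lt_pref hθ hj
  have h2 := comparisons_mul_sq_le hα hgood hij.symm (by linarith) hle.le
  rw [e1, add_comm] at h2
  refine ⟨g, i, j, hg, hj, hij, hiR, hjR, le_mul_of_mul_sq_le (by linarith)
    (Real.log_natCast_nonneg t) h2 ?_⟩
  unfold pairConst
  rw [if_neg (by rw [hi]; exact lt_irrefl _), if_neg (by rw [hi]; exact lt_irrefl _)]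

include hθ hα hgood in
/-- A worse item `j` that could do as well as `g` against an item `i` at least as good as `g`. -/
theorem uncertain_of_ge {k : ℕ} {R : Finset (Fin n)} {g i j : Fin n} (hg : g.val < k)
    (hi : θ g ≤ θ i) (hj : θ j < θ g) (hiR : i ∈ R) (hjR : j ∈ R)
    (hle : (pref θ g i : EReal) ≤ ucb α u₀ t W j i) : Uncertain α θ k t W R := by
  have hij : i ≠ j := fun e => absurd hj (not_lt.2 (e ▸ hi))
  have h1 := pref_lt_pref hθ i hj
  have h2 := comparisons_mul_sq_le hα hgood hij.symm h1 hle
  rw [add_comm] at h2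
  refine ⟨g, i, j, hg, hj, hij, hiR, hjR, le_mul_of_mul_sq_le (sub_pos.2 h1)
    (Real.log_natCast_nonneg t) h2 ?_⟩
  unfold pairConst
  rw [if_neg (not_lt.2 hi)]
  split_ifs with h3
  · exact le_rfl
  · have e : θ i = θ g := le_antisymm (not_lt.1 h3) hi
    refine le_of_eq ?_
    have e1 := pref_add_pref hθ g g
    have e2 := pref_add_pref hθ g j
    rw [pref_congr rfl e, pref_congr rfl e]
    congr 2
    linarith

include hθ hα in
/-- Two worse items, of which `i` could do as well as `g` against `j`, and `j` could beat `i`. -/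
theorem uncertain_of_lt {k : ℕ} {R : Finset (Fin n)} {g i j : Fin n} (hg : g.val < k)
    (hi : θ i < θ g) (hj : θ j < θ g) (hij : i ≠ j) (hiR : i ∈ R) (hjR : j ∈ R)
    (hle : (pref θ g j : EReal) ≤ ucb α u₀ t W i j)
    (hle' : ((1 / 2 : ℝ) : EReal) < ucb α u₀ t W j i) : Uncertain α θ k t W R := by
  have h1 := half_lt_pref hθ hj
  have h1' := half_lt_pref hθ hi
  have h2 := comparisons_mul_sq_le_of_both hα hij h1 hle hle'
  refine ⟨g, i, j, hg, hj, hij, hiR, hjR, le_mul_of_mul_sq_le (sub_pos.2 h1)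
    (Real.log_natCast_nonneg t) h2 ?_⟩
  unfold pairConst
  rw [if_pos hi]
  refine div_le_div_of_nonneg_left (by positivity) (lt_min ?_ ?_) (min_le_right _ _)
  · exact pow_pos (sub_pos.2 h1') 2
  · exact pow_pos (sub_pos.2 h1) 2

theorem mem_cand {U : Fin n → Fin n → EReal} {I : Finset (Fin n)} {i : Fin n} :
    i ∈ cand U I ↔ i ∈ I ∧ ∀ j ∈ I, j ≠ i → ((1 / 2 : ℝ) : EReal) < U i j := by
  simp [cand]

include hθ hu₀ hgood in
/-- The best items of a pool are always potential Condorcet winners. -/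
theorem best_mem_cand {I : Finset (Fin n)} {a : Fin n} (ha : a ∈ I) (hmax : ∀ x ∈ I, θ x ≤ θ a) :
    a ∈ cand (ucb α u₀ t W) I := by
  refine mem_cand.2 ⟨ha, fun j hj hja => ?_⟩
  refine lt_of_le_of_lt ?_ (pref_lt_ucb hθ hu₀ hgood hja.symm)
  rw [EReal.coe_le_coe_iff]
  exact half_le_pref hθ (hmax j hj)

include hθ hu₀ hgood in
/-- The max-min score of the drawn item is at least that of any other candidate `a`, hence at
least the preference of `a` against the strongest item of `S`. -/
theorem pref_le_ucb_of_mem_maxMin {S C : Finset (Fin n)} {a c i : Fin n} (ha : a ∈ C)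
    (haS : a ∉ S) (hc : c ∈ maxMin (ucb α u₀ t W) S C) (hi : i ∈ S)
    (hmax : ∀ x ∈ S, θ x ≤ θ i) : (pref θ a i : EReal) ≤ ucb α u₀ t W c i := by
  have h1 : (pref θ a i : EReal) ≤ S.inf (ucb α u₀ t W a) := by
    refine Finset.le_inf fun x hx => ?_
    refine le_trans ?_ (pref_lt_ucb hθ hu₀ hgood (ne_of_mem_of_not_mem hx haS).symm).le
    rw [EReal.coe_le_coe_iff]
    exact pref_le_pref_right hθ a (hmax x hx)
  exact h1.trans (((mem_filter.1 hc).2 a ha).trans (Finset.inf_le hi))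

end Bounds

/-! ### The items drawn in a round -/

section Draws

variable {n : ℕ} (τ : TieRule n) (U : Fin n → Fin n → EReal)

theorem pick_mem_maxMin (S : Finset (Fin n)) {C : Finset (Fin n)} (hC : C.Nonempty) :
    pick τ U S C ∈ maxMin U S C :=
  τ.sel_mem S _ (maxMin_nonempty U S hC)

theorem subset_drawMany (ℓ : ℕ) (S C : Finset (Fin n)) : S ⊆ drawMany τ U ℓ S C := by
  induction ℓ generalizing S C with
  | zero => exact Finset.Subset.refl S
  | succ ℓ ih => exact (Finset.subset_insert _ _).trans (ih _ _)

theorem subset_buildS (S I : Finset (Fin n)) (ℓ : ℕ) : S ⊆ buildS τ U S I ℓ := by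
  induction S, I, ℓ using buildS.induct (U := U) with
  | case1 S I ℓ h ih =>
    rw [buildS, dif_pos h]
    exact Finset.subset_union_left.trans ih
  | case2 S I ℓ h =>
    rw [buildS, dif_neg h]
    exact subset_drawMany τ U ℓ S _

theorem subset_fillSlots (k : ℕ) (B : ℕ → Option (Fin n)) (m h : ℕ) (S I : Finset (Fin n)) :
    S ⊆ (fillSlots τ k U B m h S I).2 := by
  induction m generalizing h S I with
  | zero =>
    rw [fillSlots]
    split_ifs
    · exact Finset.subset_union_left
    · exact subset_buildS τ U _ _ _
  | succ m ih =>
    rw [fillSlots]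
    split
    · exact (Finset.subset_insert _ _).trans (ih _ _ _)
    · split_ifs <;> exact subset_buildS τ U _ _ _

theorem pool_eq_cand {I : Finset (Fin n)} (h : (cand U I).Nonempty) : pool U I = cand U I :=
  if_neg h.ne_empty

theorem pick_mem_buildS {S I : Finset (Fin n)} {ℓ : ℕ} (hℓ : 1 ≤ ℓ) (h : (cand U I).Nonempty) :
    pick τ U S (cand U I) ∈ buildS τ U S I ℓ := by
  rw [buildS]
  split_ifs with h1
  · refine subset_buildS τ U _ _ _ (mem_union_right _ ?_)
    rw [pool_eq_cand U h]
    exact pick_mem τ U S h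
  · obtain ⟨ℓ, rfl⟩ := Nat.exists_eq_add_of_le' hℓ
    rw [pool_eq_cand U h, drawMany]
    exact subset_drawMany τ U _ _ _ (mem_insert_self _ _)

theorem mem_cand_of_filter {I : Finset (Fin n)} {o : Option (Fin n)} {b : Fin n}
    (hb : (o.filter fun b => decide (b ∈ cand U I)) = some b) : o = some b ∧ b ∈ cand U I := by
  rw [Option.filter_eq_some_iff] at hb
  exact ⟨hb.1, of_decide_eq_true hb.2⟩

end Draws

section Dichotomy

variable {n : ℕ} {θ : Fin n → ℝ} (hθ : ∀ i, 0 < θ i) {α : ℝ} (hα : 0 < α) {u₀ : EReal}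
  (hu₀ : 1 ≤ u₀) {t : ℕ} {W : Fin n → Fin n → ℕ} (hgood : ¬ BoundFails α θ t W)
include hθ hα hu₀ hgood

/-- Max-min draws from a set of potential Condorcet winners that contains a best item `a` either
add an item as good as `a`, or add an item that forms an uncertain pair.  The second alternative
appears as soon as the set built so far is not empty, with its strongest item as partner. -/
theorem drawMany_dichotomy (τ : TieRule n) {k : ℕ} {a g : Fin n} (hg : g.val < k)
    (hag : θ a = θ g) (ℓ : ℕ) :
    ∀ S C : Finset (Fin n), a ∈ C → (∀ c ∈ C, θ c ≤ θ g) → Disjoint S C →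
      (∀ i ∈ S, θ g ≤ θ i ∨ ∀ c ∈ C, ((1 / 2 : ℝ) : EReal) < ucb α u₀ t W i c) →
      (∀ i ∈ C, ∀ c ∈ C, c ≠ i → ((1 / 2 : ℝ) : EReal) < ucb α u₀ t W i c) →
      (S.Nonempty ∧ 1 ≤ ℓ ∨ 2 ≤ ℓ) →
      (∃ c ∈ C, c ∈ drawMany τ (ucb α u₀ t W) ℓ S C ∧ θ c = θ g) ∨
        Uncertain α θ k t W (drawMany τ (ucb α u₀ t W) ℓ S C) := by
  induction ℓ with
  | zero => intro S C _ _ _ _ _ h; omega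
  | succ ℓ ih =>
    intro S C ha hC hd hS hCC hℓ
    rw [drawMany]
    set c := pick τ (ucb α u₀ t W) S C with hc
    have hcM : c ∈ maxMin (ucb α u₀ t W) S C := pick_mem_maxMin τ _ S ⟨a, ha⟩
    have hcC : c ∈ C := pick_mem τ _ S ⟨a, ha⟩
    have hsub := subset_drawMany τ (ucb α u₀ t W) ℓ (insert c S) (C.erase c)
    have hcR := hsub (mem_insert_self c S)
    by_cases hcg : θ c = θ g
    · exact Or.inl ⟨c, hcC, hcR, hcg⟩
    have hclt : θ c < θ g := lt_of_le_of_ne (hC c hcC) hcg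
    rcases S.eq_empty_or_nonempty with rfl | hne
    · have hac : a ≠ c := fun e => hcg (by rw [← e, hag])
      have h2 : 2 ≤ ℓ + 1 := by simpa using hℓ
      rcases ih (insert c ∅) (C.erase c) (mem_erase.2 ⟨hac, ha⟩)
        (fun x hx => hC x (mem_of_mem_erase hx)) (by simp)
        (fun i hi => Or.inr fun x hx => by
          have e : i = c := by simpa using hi
          subst e
          exact hCC _ hcC x (mem_of_mem_erase hx) (ne_of_mem_erase hx))
        (fun i hi x hx => hCC i (mem_of_mem_erase hi) x (mem_of_mem_erase hx))
        (Or.inl ⟨⟨c, mem_insert_self _ _⟩, by omega⟩) with ⟨x, hx, h⟩ | h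
      · exact Or.inl ⟨x, mem_of_mem_erase hx, h⟩
      · exact Or.inr h
    · right
      obtain ⟨i, hi, hmax⟩ := Finset.exists_max_image S θ hne
      have hiR := hsub (mem_insert_of_mem hi)
      have hle := pref_le_ucb_of_mem_maxMin hθ hu₀ hgood ha
        (fun h => Finset.disjoint_left.1 hd h ha) hcM hi hmax
      rw [pref_congr hag rfl] at hle
      rcases le_or_gt (θ g) (θ i) with hgi | hgi
      · exact uncertain_of_ge hθ hα hgood hg hgi hclt hiR hcR hle
      · refine uncertain_of_lt hθ hα hg hclt hgi ?_ hcR hiR hle ?_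
        · exact fun e => Finset.disjoint_left.1 hd hi (e ▸ hcC)
        · exact ((hS i hi).resolve_left (not_le.2 hgi)) c hcC

theorem buildS_dichotomy (τ : TieRule n) {k : ℕ} {a g : Fin n} (hg : g.val < k)
    (hag : θ a = θ g) {S I : Finset (Fin n)} {ℓ : ℕ} (ha : a ∈ I) (hI : ∀ c ∈ I, θ c ≤ θ g)
    (hd : Disjoint S I)
    (hS : ∀ i ∈ S, θ g ≤ θ i ∨ ∀ c ∈ I, ((1 / 2 : ℝ) : EReal) < ucb α u₀ t W i c)
    (hℓ : S.Nonempty ∧ 1 ≤ ℓ ∨ 2 ≤ ℓ) :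
    (∃ c ∈ I, c ∈ buildS τ (ucb α u₀ t W) S I ℓ ∧ θ c = θ g) ∨
      Uncertain α θ k t W (buildS τ (ucb α u₀ t W) S I ℓ) := by
  have hac : a ∈ cand (ucb α u₀ t W) I :=
    best_mem_cand hθ hu₀ hgood ha fun x hx => (hI x hx).trans_eq hag.symm
  have hsub : cand (ucb α u₀ t W) I ⊆ I := Finset.filter_subset _ _
  rw [buildS]
  split_ifs with h1
  · refine Or.inl ⟨a, ha, subset_buildS τ _ _ _ _ (mem_union_right _ ?_), hag⟩
    rwa [pool_eq_cand _ ⟨a, hac⟩]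
  · rw [pool_eq_cand _ ⟨a, hac⟩]
    rcases drawMany_dichotomy hθ hα hu₀ hgood τ hg hag ℓ S _ hac (fun c hc => hI c (hsub hc))
      (hd.mono_right hsub) (fun i hi => (hS i hi).imp_right fun h c hc => h c (hsub hc))
      (fun i hi c hc => (mem_cand.1 hi).2 c (hsub hc)) hℓ with ⟨c, hc, h⟩ | h
    · exact Or.inl ⟨c, hsub hc, h⟩
    · exact Or.inr h

theorem fillSlots_dichotomy (τ : TieRule n) {k : ℕ} (hk : 2 ≤ k) (B : ℕ → Option (Fin n))
    {a g : Fin n} (hg : g.val < k) (hag : θ a = θ g) (m : ℕ) :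
    ∀ (h : ℕ) (S I : Finset (Fin n)), a ∈ I → (∀ c ∈ I, θ c ≤ θ g) → Disjoint S I →
      (∀ i ∈ S, θ g ≤ θ i ∨ ∀ c ∈ I, ((1 / 2 : ℝ) : EReal) < ucb α u₀ t W i c) →
      S.card + (m + 1) = k →
      (∃ c ∈ I, c ∈ (fillSlots τ k (ucb α u₀ t W) B m h S I).2 ∧ θ c = θ g) ∨
        Uncertain α θ k t W (fillSlots τ k (ucb α u₀ t W) B m h S I).2 := by
  induction m with
  | zero =>
    intro h S I ha hI hd hS hc
    have hac : a ∈ cand (ucb α u₀ t W) I :=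
      best_mem_cand hθ hu₀ hgood ha fun x hx => (hI x hx).trans_eq hag.symm
    rw [fillSlots]
    split_ifs with h1
    · exact Or.inl ⟨a, ha, mem_union_right _ hac, hag⟩
    · exact buildS_dichotomy hθ hα hu₀ hgood τ hg hag ha hI hd hS
        (Or.inl ⟨Finset.card_pos.1 (by omega), le_rfl⟩)
  | succ m ih =>
    intro h S I ha hI hd hS hc
    have hac : a ∈ cand (ucb α u₀ t W) I :=
      best_mem_cand hθ hu₀ hgood ha fun x hx => (hI x hx).trans_eq hag.symm
    rw [fillSlots]
    split
    · next b hb =>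
      obtain ⟨hbc, hbhalf⟩ := mem_cand.1 (mem_cand_of_filter _ hb).2
      have hbS : b ∉ S := fun h => Finset.disjoint_left.1 hd h hbc
      by_cases hbg : θ b = θ g
      · exact Or.inl ⟨b, hbc, subset_fillSlots τ _ _ _ _ _ _ _ (mem_insert_self b S), hbg⟩
      · have hab : a ≠ b := fun e => hbg (by rw [← e, hag])
        rcases ih (h + 1) (insert b S) (I.erase b) (mem_erase.2 ⟨hab, ha⟩)
          (fun x hx => hI x (mem_of_mem_erase hx))
          (by
            rw [Finset.disjoint_insert_left]
            exact ⟨Finset.notMem_erase _ _, hd.mono_right (Finset.erase_subset _ _)⟩)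
          (fun i hi => by
            rcases mem_insert.1 hi with rfl | hi
            · exact Or.inr fun c hc => hbhalf c (mem_of_mem_erase hc) (ne_of_mem_erase hc)
            · exact (hS i hi).imp_right fun h c hc => h c (mem_of_mem_erase hc))
          (by rw [Finset.card_insert_of_notMem hbS]; omega) with ⟨c, hc, h⟩ | h
        · exact Or.inl ⟨c, mem_of_mem_erase hc, h⟩
        · exact Or.inr h
    · rw [if_neg (Finset.nonempty_iff_ne_empty.1 ⟨a, hac⟩)]
      exact buildS_dichotomy hθ hα hu₀ hgood τ hg hag ha hI hd hS (Or.inr (by omega))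

end Dichotomy

/-! ### Slots that hold the best items -/

/-- The slots `0, …, h - 1` hold items that are chosen greedily by decreasing `θ`, and `S` is the
set of these items. -/
def TopSlots {n : ℕ} (θ : Fin n → ℝ) (B : ℕ → Option (Fin n)) : ℕ → Finset (Fin n) → Prop
  | 0, S => S = ∅
  | h + 1, S => ∃ S' b, TopSlots θ B h S' ∧ B h = some b ∧ b ∉ S' ∧ (∀ x, x ∉ S' → θ x ≤ θ b) ∧
      S = insert b S'

section TopSlots

variable {n : ℕ} {θ : Fin n → ℝ} {B : ℕ → Option (Fin n)}

theorem TopSlots.card {h : ℕ} {S : Finset (Fin n)} (hS : TopSlots θ B h S) : S.card = h := by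
  induction h generalizing S with
  | zero => rw [TopSlots] at hS; simp [hS]
  | succ h ih =>
    obtain ⟨S', b, h1, _, h2, _, rfl⟩ := hS
    rw [Finset.card_insert_of_notMem h2, ih h1]

theorem TopSlots.congr {B' : ℕ → Option (Fin n)} {h : ℕ} {S : Finset (Fin n)}
    (hS : TopSlots θ B h S) (hB : ∀ l < h, B' l = B l) : TopSlots θ B' h S := by
  induction h generalizing S with
  | zero => exact hS
  | succ h ih =>
    obtain ⟨S', b, h1, h2, h3⟩ := hS
    exact ⟨S', b, ih h1 fun l hl => hB l (hl.trans (Nat.lt_succ_self h)),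
      by rw [hB h (Nat.lt_succ_self h), h2], h3⟩

theorem TopSlots.le {h : ℕ} {S : Finset (Fin n)} (hS : TopSlots θ B h S) {s x : Fin n}
    (hs : s ∈ S) (hx : x ∉ S) : θ x ≤ θ s := by
  induction h generalizing S with
  | zero => rw [TopSlots] at hS; simp [hS] at hs
  | succ h ih =>
    obtain ⟨S', b, h1, _, _, h2, rfl⟩ := hS
    have hx' : x ∉ S' := fun h => hx (mem_insert_of_mem h)
    rcases mem_insert.1 hs with rfl | hs
    · exact h2 x hx'
    · exact ih h1 hs hx'

/-- A best item outside a set of `h` best items has the same `θ` as item `h`. -/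
theorem TopSlots.eq_of_best (hanti : Antitone θ) {h : ℕ} {S : Finset (Fin n)}
    (hS : TopSlots θ B h S) (hn : h < n) {a : Fin n} (ha : a ∉ S)
    (hmax : ∀ x, x ∉ S → θ x ≤ θ a) : θ a = θ ⟨h, hn⟩ := by
  have hcard := hS.card
  refine le_antisymm ?_ ?_
  · by_contra hlt
    rw [not_le] at hlt
    -- all items at least as good as `a` come before item `h`
    have hsub : insert a S ⊆ Finset.Iio (⟨h, hn⟩ : Fin n) := by
      intro i hi
      refine Finset.mem_Iio.2 ?_
      by_contra hge
      have h1 := hanti (not_lt.1 hge)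
      rcases mem_insert.1 hi with rfl | hi
      · linarith
      · linarith [hS.le hi ha]
    have h2 := Finset.card_le_card hsub
    rw [Finset.card_insert_of_notMem ha, hcard, Fin.card_Iio] at h2
    simp at h2
  · by_contra hlt
    rw [not_le] at hlt
    -- the items up to item `h` are better than `a`, hence belong to the set
    have hsub : Finset.Iic (⟨h, hn⟩ : Fin n) ⊆ S := by
      intro i hi
      by_contra hiS
      linarith [hmax i hiS, hanti (Finset.mem_Iic.1 hi)]
    have h2 := Finset.card_le_card hsub
    rw [hcard, Fin.card_Iic] at h2
    simp at h2

theorem TopSlots.sum_eq (hanti : Antitone θ) {h : ℕ} {S : Finset (Fin n)}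
    (hS : TopSlots θ B h S) (hn : h ≤ n) : ∑ i ∈ S, θ i = ∑ i with i.val < h, θ i := by
  induction h generalizing S with
  | zero => rw [TopSlots] at hS; simp [hS]
  | succ h ih =>
    obtain ⟨S', b, h1, _, h3, h4, rfl⟩ := hS
    rw [Finset.sum_insert h3, ih h1 (by omega), h1.eq_of_best hanti (by omega) h3 h4]
    have e : (univ.filter fun i : Fin n => i.val < h + 1)
        = insert ⟨h, by omega⟩ (univ.filter fun i : Fin n => i.val < h) := by
      ext i
      simp only [mem_filter, mem_univ, true_and, mem_insert, Fin.ext_iff]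
      omega
    rw [e, Finset.sum_insert (by simp)]

end TopSlots

section Rounds

variable {n : ℕ} {θ : Fin n → ℝ} (hθ : ∀ i, 0 < θ i) {α : ℝ} (hα : 0 < α) {u₀ : EReal}
  (hu₀ : 1 ≤ u₀) {t : ℕ} {W : Fin n → Fin n → ℕ} (hgood : ¬ BoundFails α θ t W)
include hθ hu₀ hgood

/-- While the confidence bounds are valid, slots that hold the best items are kept. -/
theorem fillSlots_of_topSlots (τ : TieRule n) (k : ℕ) {B : ℕ → Option (Fin n)} (m : ℕ) {h : ℕ} :
    ∀ {S : Finset (Fin n)}, TopSlots θ B h S → h ≤ m →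
      (fillSlots τ k (ucb α u₀ t W) B m 0 ∅ univ).2
        = (fillSlots τ k (ucb α u₀ t W) B (m - h) h S Sᶜ).2 ∧
      (∀ l < h, (fillSlots τ k (ucb α u₀ t W) B m 0 ∅ univ).1 l = B l) ∧
      ∀ l, h ≤ l → (fillSlots τ k (ucb α u₀ t W) B m 0 ∅ univ).1 l
        = (fillSlots τ k (ucb α u₀ t W) B (m - h) h S Sᶜ).1 l := by
  induction h with
  | zero =>
    intro S hS _
    rw [TopSlots] at hS
    subst hS
    simp
  | succ h ih =>
    intro S hS hm
    obtain ⟨S', b, h1, h2, h3, h4, rfl⟩ := hS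
    obtain ⟨i1, i2, i3⟩ := ih h1 (by omega)
    have hbc : b ∈ cand (ucb α u₀ t W) S'ᶜ :=
      best_mem_cand hθ hu₀ hgood (mem_compl.2 h3) fun x hx => h4 x (mem_compl.1 hx)
    have e : fillSlots τ k (ucb α u₀ t W) B (m - h) h S' S'ᶜ
        = (Function.update (fillSlots τ k (ucb α u₀ t W) B (m - (h + 1)) (h + 1) (insert b S')
            (insert b S')ᶜ).1 h (some b),
          (fillSlots τ k (ucb α u₀ t W) B (m - (h + 1)) (h + 1) (insert b S')
            (insert b S')ᶜ).2) := by
      rw [show m - h = m - (h + 1) + 1 by omega, fillSlots, Finset.compl_insert]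
      have hf : ((B h).filter fun b => decide (b ∈ cand (ucb α u₀ t W) S'ᶜ)) = some b := by
        rw [h2, Option.filter_eq_some_iff]
        exact ⟨rfl, decide_eq_true hbc⟩
      rw [hf]
    rw [e] at i1 i3
    refine ⟨i1, fun l hl => ?_, fun l hl => ?_⟩
    · rcases Nat.lt_succ_iff_lt_or_eq.1 hl with hl | rfl
      · exact i2 l hl
      · rw [i3 l le_rfl, h2]
        simp
    · rw [i3 l (by omega)]
      simp only
      rw [Function.update_of_ne (by omega)]

include hα in
/-- A round with valid confidence bounds in which slots `0, …, h - 1`, but not yet all of the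
first `k - 1` slots, hold best items either adds a best item in slot `h`, or plays an uncertain
pair. -/
theorem fillSlots_progress (hanti : Antitone θ) (τ : TieRule n) {k : ℕ} (hkn : k < n)
    {B : ℕ → Option (Fin n)} {h : ℕ} {S : Finset (Fin n)} (hS : TopSlots θ B h S)
    (hh : h < k - 1) :
    TopSlots θ (fillSlots τ k (ucb α u₀ t W) B (k - 1) 0 ∅ univ).1 h S ∧
      ((∃ S', TopSlots θ (fillSlots τ k (ucb α u₀ t W) B (k - 1) 0 ∅ univ).1 (h + 1) S') ∨
        Uncertain α θ k t W (fillSlots τ k (ucb α u₀ t W) B (k - 1) 0 ∅ univ).2) := by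
  obtain ⟨e2, el, eh⟩ := fillSlots_of_topSlots hθ hu₀ hgood τ k (k - 1) hS hh.le
  have hS' := hS.congr el
  refine ⟨hS', ?_⟩
  have hcard := hS.card
  obtain ⟨a, ha, hmax⟩ := Finset.exists_max_image Sᶜ θ (by
    rw [← Finset.card_pos, Finset.card_compl, Fintype.card_fin]; omega)
  have hmax' : ∀ x, x ∉ S → θ x ≤ θ a := fun x hx => hmax x (mem_compl.2 hx)
  have hag := hS.eq_of_best hanti (by omega) (mem_compl.1 ha) hmax'
  set g : Fin n := ⟨h, by omega⟩ with hgdef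
  have hg : g.val < k := by simp only [hgdef]; omega
  have hac : a ∈ cand (ucb α u₀ t W) Sᶜ := best_mem_cand hθ hu₀ hgood ha hmax
  have hdich := fillSlots_dichotomy hθ hα hu₀ hgood τ (by omega) B hg hag (k - 1 - h) h S Sᶜ ha
    (fun c hc => (hmax c hc).trans_eq hag) disjoint_compl_right
    (fun i hi => Or.inl (by rw [← hag]; exact hS.le hi (mem_compl.1 ha))) (by omega)
  -- the new item of slot `h` is a potential Condorcet winner of the pool, and it is played
  obtain ⟨j, hj1, hj2, hj3⟩ : ∃ j,
      (fillSlots τ k (ucb α u₀ t W) B (k - 1 - h) h S Sᶜ).1 h = some j ∧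
      j ∈ cand (ucb α u₀ t W) Sᶜ ∧ j ∈ (fillSlots τ k (ucb α u₀ t W) B (k - 1 - h) h S Sᶜ).2 := by
    rw [show k - 1 - h = k - 1 - (h + 1) + 1 by omega, fillSlots]
    split
    · next b hb =>
      refine ⟨b, by simp, (mem_cand_of_filter _ hb).2, ?_⟩
      exact subset_fillSlots τ _ _ _ _ _ _ _ (mem_insert_self b S)
    · rw [if_neg (Finset.nonempty_iff_ne_empty.1 ⟨a, hac⟩)]
      exact ⟨_, by simp, pick_mem τ _ S ⟨a, hac⟩,
        pick_mem_buildS τ _ (by omega) ⟨a, hac⟩⟩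
  have hjS : j ∉ S := mem_compl.1 (mem_cand.1 hj2).1
  by_cases hja : θ j = θ a
  · left
    exact ⟨insert j S, S, j, hS', by rw [eh h le_rfl, hj1], hjS,
      fun x hx => (hmax' x hx).trans_eq hja.symm, rfl⟩
  · right
    rw [e2]
    have hjg : θ j < θ g := by rw [← hag]; exact lt_of_le_of_ne (hmax' j hjS) hja
    rcases hdich with ⟨c, hcI, hcR, hcg⟩ | h
    · refine uncertain_of_eq (u₀ := u₀) hθ hα hgood hg hcg hjg hcR hj3 ?_
      exact (mem_cand.1 hj2).2 c hcI fun e => hjg.ne (by rw [← e, hcg])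
    · exact h

include hα in
/-- Once the first `k - 1` slots hold best items, a single further item is played.  If it is not
as good as item `k - 1`, then it was rarely compared with the strongest items. -/
theorem fillSlots_settled (hanti : Antitone θ) (τ : TieRule n) {k : ℕ} (hk : 1 ≤ k) (hkn : k < n)
    {B : ℕ → Option (Fin n)} {S : Finset (Fin n)} (hS : TopSlots θ B (k - 1) S) :
    TopSlots θ (fillSlots τ k (ucb α u₀ t W) B (k - 1) 0 ∅ univ).1 (k - 1) S ∧
    ∃ b, b ∉ S ∧ (fillSlots τ k (ucb α u₀ t W) B (k - 1) 0 ∅ univ).2 = insert b S ∧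
      θ b ≤ θ ⟨k - 1, by omega⟩ ∧
      ∀ i ∈ S, (∀ x ∈ S, θ x ≤ θ i) → θ b < θ ⟨k - 1, by omega⟩ →
        ((W b i + W i b : ℕ) : ℝ) * (pref θ ⟨k - 1, by omega⟩ i - pref θ b i) ^ 2
          ≤ 4 * α * Real.log t := by
  obtain ⟨e2, el, -⟩ := fillSlots_of_topSlots hθ hu₀ hgood τ k (k - 1) hS le_rfl
  refine ⟨hS.congr el, ?_⟩
  have hcard := hS.card
  obtain ⟨a, ha, hmax⟩ := Finset.exists_max_image Sᶜ θ (by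
    rw [← Finset.card_pos, Finset.card_compl, Fintype.card_fin]; omega)
  have hmax' : ∀ x, x ∉ S → θ x ≤ θ a := fun x hx => hmax x (mem_compl.2 hx)
  have hag := hS.eq_of_best hanti (by omega) (mem_compl.1 ha) hmax'
  have hac : a ∈ cand (ucb α u₀ t W) Sᶜ := best_mem_cand hθ hu₀ hgood ha hmax
  rw [e2, Nat.sub_self, fillSlots]
  split_ifs with h1
  · obtain ⟨a', ha'⟩ := Finset.card_eq_one.1 h1
    have : a = a' := by rw [ha'] at hac; simpa using hac
    subst this
    refine ⟨a, mem_compl.1 ha, ?_, hag.le, fun i _ _ hlt => absurd hag hlt.ne⟩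
    change S ∪ cand (ucb α u₀ t W) Sᶜ = insert a S
    rw [ha', Finset.union_comm, Finset.insert_eq]
  · have hpos : 1 ≤ (cand (ucb α u₀ t W) Sᶜ).card := Finset.card_pos.2 ⟨a, hac⟩
    have hbuild : buildS τ (ucb α u₀ t W) S Sᶜ 1
        = insert (pick τ (ucb α u₀ t W) S (cand (ucb α u₀ t W) Sᶜ)) S := by
      rw [buildS, pool_eq_cand _ ⟨a, hac⟩, dif_neg (by omega)]
      rfl
    rw [hbuild]
    set c := pick τ (ucb α u₀ t W) S (cand (ucb α u₀ t W) Sᶜ) with hc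
    have hcS : c ∉ S := mem_compl.1 (mem_cand.1 (pick_mem τ _ S ⟨a, hac⟩)).1
    refine ⟨c, hcS, rfl, (hmax' c hcS).trans_eq hag, fun i hi hmi hlt => ?_⟩
    have hle := pref_le_ucb_of_mem_maxMin hθ hu₀ hgood hac (mem_compl.1 ha)
      (pick_mem_maxMin τ _ S ⟨a, hac⟩) hi hmi
    rw [pref_congr hag rfl] at hle
    exact comparisons_mul_sq_le hα hgood (ne_of_mem_of_not_mem hi hcS).symm
      (pref_lt_pref hθ i hlt) hle

end Rounds

/-! ### Instantaneous regret -/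

section Regret

variable {n k : ℕ} {θ : Fin n → ℝ} (hanti : Antitone θ)
include hanti

theorem sum_last_le (hk : 1 ≤ k) (hkn : k ≤ n) {S : Finset (Fin n)} (hS : S.card = k) :
    ∑ i with n - k ≤ i.val, θ i ≤ ∑ i ∈ S, θ i := by
  set L : Finset (Fin n) := univ.filter fun i => n - k ≤ i.val with hL
  set c : Fin n := ⟨n - k, by omega⟩ with hc
  have hLcard : L.card = k := by
    have e : L = Finset.Ici c := by
      ext i
      simp [hL, hc, Fin.le_def]
    rw [e, Fin.card_Ici]
    simp only [hc]
    omega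
  have h1 : ∑ i ∈ L \ S, θ i ≤ (L \ S).card • θ c := by
    refine Finset.sum_le_card_nsmul _ _ _ fun i hi => hanti ?_
    exact Fin.le_def.2 (mem_filter.1 (mem_sdiff.1 hi).1).2
  have h2 : (S \ L).card • θ c ≤ ∑ i ∈ S \ L, θ i := by
    refine Finset.card_nsmul_le_sum _ _ _ fun i hi => hanti ?_
    have h3 := (mem_sdiff.1 hi).2
    rw [hL, mem_filter, not_and, not_le] at h3
    exact Fin.le_def.2 (h3 (mem_univ i)).le
  rw [Finset.card_sdiff_comm (hLcard.trans hS.symm)] at h1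
  have h4 := Finset.sum_inter_add_sum_sdiff L S θ
  have h5 := Finset.sum_inter_add_sum_sdiff S L θ
  rw [Finset.inter_comm] at h5
  linarith

theorem instRegret_le_regretMax (hk : 1 ≤ k) (hkn : k ≤ n) {S : Finset (Fin n)}
    (hS : S.card = k) : instRegret θ k S ≤ regretMax θ k := by
  unfold instRegret regretMax
  have := sum_last_le hanti hk hkn hS
  gcongr

omit hanti in
theorem sum_lt_succ_pred (hk : 1 ≤ k) (hkn : k ≤ n) :
    ∑ i : Fin n with i.val < k, θ i
      = θ ⟨k - 1, by omega⟩ + ∑ i : Fin n with i.val < k - 1, θ i := by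
  rw [← Finset.sum_insert (by simp)]
  refine Finset.sum_congr ?_ fun _ _ => rfl
  ext i
  simp only [mem_filter, mem_univ, true_and, mem_insert, Fin.ext_iff]
  omega

theorem swap_regret_le_regretMax (hk : 1 ≤ k) (hkn : k ≤ n) (b : Fin n) (hb : k - 1 ≤ b.val) :
    (θ ⟨k - 1, by omega⟩ - θ b) / k ≤ regretMax θ k := by
  have hbS : b ∉ univ.filter fun i : Fin n => i.val < k - 1 := by simp; omega
  have hcard : (insert b (univ.filter fun i : Fin n => i.val < k - 1)).card = k := by
    rw [Finset.card_insert_of_notMem hbS]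
    have e : (univ.filter fun i : Fin n => i.val < k - 1) = Finset.Iio ⟨k - 1, by omega⟩ := by
      ext i
      simp [Fin.lt_def]
    rw [e, Fin.card_Iio]
    simp only
    omega
  refine le_trans (le_of_eq ?_) (instRegret_le_regretMax hanti hk hkn hcard)
  unfold instRegret
  rw [Finset.sum_insert hbS, sum_lt_succ_pred hk hkn]
  ring

theorem regretMax_nonneg (hk : 1 ≤ k) (hkn : k ≤ n) : 0 ≤ regretMax θ k := by
  have h := swap_regret_le_regretMax hanti hk hkn ⟨k - 1, by omega⟩ le_rfl
  rwa [sub_self, zero_div] at h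

end Regret

/-! ### Size of the problem-dependent constants -/

section Constants

variable {n k : ℕ} {θ : Fin n → ℝ} (hθ : ∀ i, 0 < θ i) {α : ℝ} (hα : 1 < α)

theorem four_le_div_sq {x : ℝ} (hα : 1 < α) (h0 : 0 < x) (h1 : x ≤ 1) : 4 ≤ 4 * α / x ^ 2 := by
  rw [le_div_iff₀ (by positivity)]
  have : x ^ 2 ≤ 1 := pow_le_one₀ h0.le h1
  nlinarith

include hθ hα in
theorem four_le_pairConst {g i j : Fin n} (hj : θ j < θ g) : 4 ≤ pairConst α θ g i j := by
  have hj1 := half_lt_pref hθ hj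
  have hj2 := pref_lt_one hθ g j
  unfold pairConst
  split_ifs with h1 h2
  · have hi1 := half_lt_pref hθ h1
    have hi2 := pref_lt_one hθ g i
    rcases min_cases ((pref θ g i - 1 / 2) ^ 2) ((pref θ g j - 1 / 2) ^ 2) with h | h
    · rw [h.1]; exact four_le_div_sq hα (by linarith) (by linarith)
    · rw [h.1]; exact four_le_div_sq hα (by linarith) (by linarith)
  · have h3 := pref_lt_pref hθ i hj
    have h4 := pref_pos hθ j i
    have h5 := pref_lt_one hθ g i
    exact four_le_div_sq hα (by linarith) (by linarith)
  · exact four_le_div_sq hα (by linarith) (by linarith)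

/-- The number of terms of the sum that defines `progressConst`. -/
def tripleCount (θ : Fin n → ℝ) (k : ℕ) : ℝ :=
  ∑ r with r.val < k, ∑ j with θ j < θ r, ∑ i : Fin n with i ≠ j, (1 : ℝ)

include hθ hα in
theorem four_mul_tripleCount_le : 4 * tripleCount θ k ≤ progressConst α θ k := by
  unfold tripleCount progressConst
  simp only [Finset.mul_sum]
  refine Finset.sum_le_sum fun r _ => Finset.sum_le_sum fun j hj => Finset.sum_le_sum fun i _ => ?_
  rw [mul_one]
  exact four_le_pairConst hθ hα (mem_filter.1 hj).2

theorem le_tripleCount (hanti : Antitone θ) (hk : 2 ≤ k) (hkn : k < n)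
    (hgap : θ ⟨k, hkn⟩ < θ ⟨k - 1, Nat.sub_lt_of_lt hkn⟩) :
    2 * ((n : ℝ) - 1) ≤ tripleCount θ k := by
  have hinner : ∀ j : Fin n, ∑ i : Fin n with i ≠ j, (1 : ℝ) = n - 1 := by
    intro j
    rw [Finset.filter_ne', Finset.sum_const, Finset.card_erase_of_mem (mem_univ j),
      Finset.card_univ, Fintype.card_fin, nsmul_eq_mul, mul_one,
      Nat.cast_sub (by omega), Nat.cast_one]
  have hn : (0 : ℝ) ≤ (n : ℝ) - 1 := by
    rw [sub_nonneg]; exact_mod_cast (by omega : 1 ≤ n)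
  have hr : ∀ r : Fin n, r.val < k →
      (n : ℝ) - 1 ≤ ∑ j with θ j < θ r, ∑ i : Fin n with i ≠ j, (1 : ℝ) := by
    intro r hr
    simp only [hinner]
    refine Finset.single_le_sum (f := fun _ : Fin n => (n : ℝ) - 1) (fun _ _ => hn)
      (mem_filter.2 ⟨mem_univ (⟨k, hkn⟩ : Fin n), hgap.trans_le (hanti ?_)⟩)
    rw [Fin.le_def]
    simp only
    omega
  have hsub : ({⟨0, by omega⟩, ⟨1, by omega⟩} : Finset (Fin n))
      ⊆ univ.filter fun r : Fin n => r.val < k := by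
    intro r hr
    rcases mem_insert.1 hr with rfl | hr
    · exact mem_filter.2 ⟨mem_univ _, by simp only; omega⟩
    · rw [mem_singleton] at hr
      subst hr
      exact mem_filter.2 ⟨mem_univ _, by simp only; omega⟩
  unfold tripleCount
  refine le_trans ?_ (Finset.sum_le_sum_of_subset_of_nonneg hsub fun r hr' _ =>
    hn.trans (hr r (mem_filter.1 hr').2))
  rw [Finset.sum_pair (by simp [Fin.ext_iff])]
  have h0 := hr ⟨0, by omega⟩ (by simp only; omega)
  have h1 := hr ⟨1, by omega⟩ (by simp only; omega)
  linarith

include hθ in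
theorem gapConst_pos (hk : 2 ≤ k) (hkn : k < n) {a b : Fin n} (h : θ b < θ a) :
    0 < gapConst θ k a b := by
  have : Nonempty {g : Fin n // g.val + 1 < k} := ⟨⟨⟨0, by omega⟩, by simp only; omega⟩⟩
  obtain ⟨g, hg⟩ := exists_eq_ciInf_of_finite
    (f := fun g : {g : Fin n // g.val + 1 < k} => pref θ a g - pref θ b g)
  unfold gapConst
  rw [← hg]
  exact sub_pos.2 (pref_lt_pref hθ _ h)

theorem gapConst_le (a b : Fin n) {g : Fin n} (hg : g.val + 1 < k) :
    gapConst θ k a b ≤ pref θ a g - pref θ b g :=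
  ciInf_le (f := fun g : {g : Fin n // g.val + 1 < k} => pref θ a g - pref θ b g)
    (Set.finite_range _).bddBelow ⟨g, hg⟩

end Constants

/-! ### Runs with eventually valid confidence bounds -/

/-- A counter that stays below `X` in the rounds of `A`, and grows in each of them, allows for at
most `X + 1` such rounds. -/
theorem card_le_of_counter {T : ℕ} {ν : ℕ → ℕ} (hmono : ∀ t < T, ν t ≤ ν (t + 1))
    {A : Finset ℕ} {X : ℝ} (hX : 0 ≤ X)
    (hA : ∀ t ∈ A, t < T ∧ ν t < ν (t + 1) ∧ (ν t : ℝ) ≤ X) : (A.card : ℝ) ≤ X + 1 := by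
  have hm : ∀ s t, s ≤ t → t ≤ T → ν s ≤ ν t := by
    intro s t hst
    induction t, hst using Nat.le_induction with
    | base => exact fun _ => le_rfl
    | succ t _ ih => exact fun h => (ih (by omega)).trans (hmono t (by omega))
  have hlt : ∀ s ∈ A, ∀ t ∈ A, s < t → ν s < ν t := fun s hs t ht hst =>
    (hA s hs).2.1.trans_le (hm (s + 1) t hst (hA t ht).1.le)
  have hinj : Set.InjOn ν A := by
    intro s hs t ht e
    rcases lt_trichotomy s t with h | h | h
    · exact absurd e (hlt s hs t ht h).ne
    · exact h
    · exact absurd e (hlt t ht s hs h).ne'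
  have hmap : A.image ν ⊆ range (⌊X⌋₊ + 1) := by
    intro x hx
    obtain ⟨t, ht, rfl⟩ := mem_image.1 hx
    exact mem_range.2 (Nat.lt_succ_of_le (Nat.le_floor (hA t ht).2.2))
  have hcard := Finset.card_le_card hmap
  rw [Finset.card_image_of_injOn hinj, card_range] at hcard
  have h1 : (A.card : ℝ) ≤ (⌊X⌋₊ : ℝ) + 1 := by exact_mod_cast hcard
  linarith [Nat.floor_le hX]

/-- A run of the algorithm over `T` rounds: win counts `W t` and slots `B t` before round `t`,
and the set `R t` played in that round, where the rounds are numbered from `0`. -/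
structure IsRun {n : ℕ} (α : ℝ) (u₀ : EReal) (k T : ℕ) (W : ℕ → Fin n → Fin n → ℕ)
    (B : ℕ → ℕ → Option (Fin n)) (R : ℕ → Finset (Fin n)) : Prop where
  step : ∀ t < T, ∃ τ : TieRule n,
    fillSlots τ k (ucb α u₀ (t + 1) (W t)) (B t) (k - 1) 0 ∅ univ = (B (t + 1), R t)
  card_eq : ∀ t < T, (R t).card = k
  mono : ∀ t < T, ∀ i j, W t i j ≤ W (t + 1) i j
  compare : ∀ t < T, ∀ i ∈ R t, ∀ j ∈ R t, i ≠ j →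
    W t i j + W t j i < W (t + 1) i j + W (t + 1) j i

section Run

variable {n k : ℕ} {θ : Fin n → ℝ} (hθ : ∀ i, 0 < θ i) (hanti : Antitone θ) {α : ℝ} (hα : 1 < α)
  {u₀ : EReal} (hu₀ : 1 ≤ u₀) {T : ℕ} {W : ℕ → Fin n → Fin n → ℕ} {B : ℕ → ℕ → Option (Fin n)}
  {R : ℕ → Finset (Fin n)} (hrun : IsRun α u₀ k T W B R)

include hrun in
theorem IsRun.counter_mono (i j : Fin n) (t : ℕ) (ht : t < T) :
    W t i j + W t j i ≤ W (t + 1) i j + W (t + 1) j i :=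
  add_le_add (hrun.mono t ht i j) (hrun.mono t ht j i)

open Classical in
include hθ hα hrun in
/-- Each round with an uncertain pair adds a comparison of that pair, so that a triple `g, i, j`
accounts for at most `D^g_{ij} ln s + 1` rounds. -/
theorem IsRun.card_uncertain_le {N s : ℕ} (hs : s ≤ T) :
    (#{t ∈ Ico N s | Uncertain α θ k (t + 1) (W t) (R t)} : ℝ)
      ≤ progressConst α θ k * Real.log s + tripleCount θ k := by
  set A : Fin n → Fin n → Fin n → Finset ℕ := fun g j i =>
    {t ∈ Ico N s | i ∈ R t ∧ j ∈ R t ∧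
      ((W t i j + W t j i : ℕ) : ℝ) ≤ pairConst α θ g i j * Real.log s} with hA
  have hsub : {t ∈ Ico N s | Uncertain α θ k (t + 1) (W t) (R t)}
      ⊆ (univ.filter fun r : Fin n => r.val < k).biUnion fun g =>
        (univ.filter fun j => θ j < θ g).biUnion fun j =>
          (univ.filter fun i => i ≠ j).biUnion fun i => A g j i := by
    intro t ht
    obtain ⟨ht, g, i, j, hg, hj, hij, hi, hjR, hle⟩ := mem_filter.1 ht
    refine mem_biUnion.2 ⟨g, mem_filter.2 ⟨mem_univ g, hg⟩, mem_biUnion.2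
      ⟨j, mem_filter.2 ⟨mem_univ j, hj⟩, mem_biUnion.2 ⟨i, mem_filter.2 ⟨mem_univ i, hij⟩, ?_⟩⟩⟩
    refine mem_filter.2 ⟨ht, hi, hjR, hle.trans (mul_le_mul_of_nonneg_left ?_ ?_)⟩
    · have h1 : t + 1 ≤ s := (mem_Ico.1 ht).2
      exact Real.log_le_log (by exact_mod_cast Nat.succ_pos t) (by exact_mod_cast h1)
    · linarith [four_le_pairConst hθ hα (i := i) hj]
  have hone : ∀ g j i, θ j < θ g → i ≠ j →
      ((A g j i).card : ℝ) ≤ pairConst α θ g i j * Real.log s + 1 := by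
    intro g j i hj hij
    refine card_le_of_counter (hrun.counter_mono i j) (mul_nonneg ?_ (Real.log_natCast_nonneg s))
      fun t ht => ?_
    · linarith [four_le_pairConst hθ hα (i := i) hj]
    · obtain ⟨ht, hi, hjR, hle⟩ := mem_filter.1 ht
      have htT : t < T := (mem_Ico.1 ht).2.trans_le hs
      exact ⟨htT, hrun.compare t htT i hi j hjR hij, hle⟩
  have hcard : #{t ∈ Ico N s | Uncertain α θ k (t + 1) (W t) (R t)}
      ≤ ∑ g with g.val < k, ∑ j with θ j < θ g, ∑ i with i ≠ j, (A g j i).card :=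
    (Finset.card_le_card hsub).trans (Finset.card_biUnion_le.trans (Finset.sum_le_sum fun g _ =>
      Finset.card_biUnion_le.trans (Finset.sum_le_sum fun j _ => Finset.card_biUnion_le)))
  calc (#{t ∈ Ico N s | Uncertain α θ k (t + 1) (W t) (R t)} : ℝ)
      ≤ ∑ g with g.val < k, ∑ j with θ j < θ g, ∑ i with i ≠ j, ((A g j i).card : ℝ) := by
        exact_mod_cast hcard
    _ ≤ ∑ g with g.val < k, ∑ j with θ j < θ g, ∑ i with i ≠ j,
          (pairConst α θ g i j * Real.log s + 1) :=
        Finset.sum_le_sum fun g _ => Finset.sum_le_sum fun j hj => Finset.sum_le_sum fun i hi =>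
          hone g j i (mem_filter.1 hj).2 (mem_filter.1 hi).2
    _ = _ := by
        unfold progressConst tripleCount
        simp only [Finset.sum_add_distrib, Finset.sum_mul]

open Classical in
include hθ hanti hα hu₀ hrun in
/-- Before the first `k - 1` slots are settled, every round with valid confidence bounds settles a
further slot or plays an uncertain pair. -/
theorem IsRun.unsettled_le (hkn : k < n) {N s : ℕ} (hNs : N ≤ s) (hs : s ≤ T)
    (hgood : ∀ t, N ≤ t → t < s → ¬ BoundFails α θ (t + 1) (W t))
    (huns : ∀ t, N ≤ t → t < s → ¬ ∃ S, TopSlots θ (B t) (k - 1) S) :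
    s ≤ N + (k - 1) + #{t ∈ Ico N s | Uncertain α θ k (t + 1) (W t) (R t)} := by
  suffices h : ∃ h ≤ k - 1, (∃ S, TopSlots θ (B s) h S) ∧
      s ≤ N + h + #{t ∈ Ico N s | Uncertain α θ k (t + 1) (W t) (R t)} by
    obtain ⟨h, h1, _, h2⟩ := h
    omega
  induction s, hNs using Nat.le_induction with
  | base => exact ⟨0, Nat.zero_le _, ⟨∅, rfl⟩, by omega⟩
  | succ s hNs ih =>
    obtain ⟨h, h1, ⟨S, hS⟩, h2⟩ := ih (by omega) (fun t h1 h2 => hgood t h1 (by omega))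
      (fun t h1 h2 => huns t h1 (by omega))
    have hlt : h < k - 1 := by
      refine lt_of_le_of_ne h1 fun e => huns s hNs (Nat.lt_succ_self s) ⟨S, e ▸ hS⟩
    obtain ⟨τ, hτ⟩ := hrun.step s (by omega)
    have hprog := fillSlots_progress hθ (by linarith) hu₀ (hgood s hNs (Nat.lt_succ_self s)) hanti
      τ hkn hS hlt
    rw [hτ] at hprog
    obtain ⟨hkeep, hor⟩ := hprog
    have hins : Ico N (s + 1) = insert s (Ico N s) :=
      (Finset.insert_Ico_right_eq_Ico_add_one hNs).symm
    rcases hor with ⟨S', hS'⟩ | hunc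
    · refine ⟨h + 1, hlt, ⟨S', hS'⟩, ?_⟩
      have : #{t ∈ Ico N s | Uncertain α θ k (t + 1) (W t) (R t)}
          ≤ #{t ∈ Ico N (s + 1) | Uncertain α θ k (t + 1) (W t) (R t)} := by
        refine Finset.card_le_card (Finset.filter_subset_filter _ ?_)
        rw [hins]
        exact Finset.subset_insert _ _
      omega
    · refine ⟨h, h1, ⟨S, hkeep⟩, ?_⟩
      rw [hins, Finset.filter_insert, if_pos hunc, Finset.card_insert_of_notMem (by simp)]
      omega

include hθ hanti hα hu₀ hrun in
/-- The regret after the first `k - 1` slots are settled.  The first term pays for the comparison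
by which each of the `n - k` worse items may exceed its bound. -/
theorem IsRun.settled_regret_le (hk : 2 ≤ k) (hkn : k < n)
    (hgap : θ ⟨k, hkn⟩ < θ ⟨k - 1, Nat.sub_lt_of_lt hkn⟩) {s : ℕ}
    (hgood : ∀ t, s ≤ t → t < T → ¬ BoundFails α θ (t + 1) (W t)) {S : Finset (Fin n)}
    (hS : TopSlots θ (B s) (k - 1) S) :
    ∑ t ∈ Ico s T, instRegret θ k (R t) ≤ ((n : ℝ) - k) * regretMax θ k
      + 4 * α * Real.log T / k * ∑ b : Fin n with k ≤ b.val,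
          (θ ⟨k - 1, Nat.sub_lt_of_lt hkn⟩ - θ b)
            / gapConst θ k ⟨k - 1, Nat.sub_lt_of_lt hkn⟩ b ^ 2 := by
  set a : Fin n := ⟨k - 1, Nat.sub_lt_of_lt hkn⟩ with ha
  have hk0 : (0 : ℝ) < k := by exact_mod_cast (by omega : 0 < k)
  have hkeep : ∀ t, s ≤ t → t ≤ T → TopSlots θ (B t) (k - 1) S := by
    intro t hst
    induction t, hst using Nat.le_induction with
    | base => exact fun _ => hS
    | succ t hst ih =>
      intro ht
      obtain ⟨τ, hτ⟩ := hrun.step t (by omega)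
      have h := (fillSlots_settled hθ (by linarith) hu₀ (hgood t hst (by omega)) hanti τ (by omega)
        hkn (ih (by omega))).1
      rwa [hτ] at h
  obtain ⟨i, hi, hmax⟩ := Finset.exists_max_image S θ
    (Finset.card_pos.1 (by rw [hS.card]; omega))
  -- the strongest item of the settled slots is as good as the best item of all
  have hi0 : θ i = θ ⟨0, by omega⟩ := by
    refine le_antisymm (hanti (Fin.le_def.2 (Nat.zero_le _))) ?_
    by_cases h0 : (⟨0, by omega⟩ : Fin n) ∈ S
    · exact hmax _ h0
    · exact hS.le hi h0
  have hround : ∀ t, ∃ b, s ≤ t → t < T → b ∉ S ∧ R t = insert b S ∧ θ b ≤ θ a ∧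
      (θ b < θ a → ((W t b i + W t i b : ℕ) : ℝ) * (pref θ a i - pref θ b i) ^ 2
        ≤ 4 * α * Real.log T) := by
    intro t
    by_cases ht : s ≤ t ∧ t < T
    · obtain ⟨τ, hτ⟩ := hrun.step t ht.2
      obtain ⟨-, b, h1, h2, h3, h4⟩ := fillSlots_settled hθ (by linarith) hu₀
        (hgood t ht.1 ht.2) hanti τ (by omega) hkn (hkeep t ht.1 ht.2.le)
      rw [hτ] at h2
      refine ⟨b, fun _ _ => ⟨h1, h2, h3, fun hlt => (h4 i hi hmax hlt).trans ?_⟩⟩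
      refine mul_le_mul_of_nonneg_left (Real.log_le_log ?_ ?_) (by linarith)
      · exact_mod_cast Nat.succ_pos t
      · exact_mod_cast ht.2
    · exact ⟨i, fun h1 h2 => absurd ⟨h1, h2⟩ ht⟩
  choose b hb using hround
  have hreg : ∀ t ∈ Ico s T, instRegret θ k (R t) = (θ a - θ (b t)) / k := by
    intro t ht
    obtain ⟨h1, h2, -⟩ := hb t (mem_Ico.1 ht).1 (mem_Ico.1 ht).2
    unfold instRegret
    rw [h2, Finset.sum_insert h1, hS.sum_eq hanti (by omega),
      sum_lt_succ_pred (by omega) hkn.le]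
    ring
  have hcount : ∀ x : Fin n, k ≤ x.val →
      (#{t ∈ Ico s T | b t = x} : ℝ) ≤ 4 * α * Real.log T / gapConst θ k a x ^ 2 + 1 := by
    intro x hx
    have hxa : θ x < θ a := lt_of_le_of_lt (hanti (Fin.le_def.2 hx)) hgap
    have hpos := gapConst_pos hθ hk hkn hxa
    have hle : gapConst θ k a x ≤ pref θ a i - pref θ x i := by
      rw [pref_congr rfl hi0, pref_congr (x := i) rfl hi0]
      exact gapConst_le a x (by simp only; omega)
    have hL : 0 ≤ 4 * α * Real.log T :=
      mul_nonneg (by linarith) (Real.log_natCast_nonneg T)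
    refine card_le_of_counter (hrun.counter_mono x i) (by positivity) fun t ht => ?_
    obtain ⟨htI, rfl⟩ := mem_filter.1 ht
    obtain ⟨h1, h2, -, h3⟩ := hb t (mem_Ico.1 htI).1 (mem_Ico.1 htI).2
    refine ⟨(mem_Ico.1 htI).2, hrun.compare t (mem_Ico.1 htI).2 (b t) ?_ i ?_ ?_, ?_⟩
    · rw [h2]; exact mem_insert_self _ _
    · rw [h2]; exact mem_insert_of_mem hi
    · exact (ne_of_mem_of_not_mem hi h1).symm
    · rw [le_div_iff₀ (by positivity)]
      refine le_trans (mul_le_mul_of_nonneg_left ?_ (Nat.cast_nonneg _)) (h3 hxa)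
      exact pow_le_pow_left₀ hpos.le hle 2
  calc ∑ t ∈ Ico s T, instRegret θ k (R t)
      = ∑ t ∈ Ico s T, (θ a - θ (b t)) / k := Finset.sum_congr rfl hreg
    _ = ∑ x, (#{t ∈ Ico s T | b t = x} : ℝ) * ((θ a - θ x) / k) := by
        rw [← Finset.sum_fiberwise (Ico s T) b]
        refine Finset.sum_congr rfl fun x _ => ?_
        rw [Finset.sum_congr rfl (g := fun _ => (θ a - θ x) / k) fun t ht => by
          rw [(mem_filter.1 ht).2], Finset.sum_const, nsmul_eq_mul]
    _ = ∑ x with k ≤ x.val, (#{t ∈ Ico s T | b t = x} : ℝ) * ((θ a - θ x) / k) := by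
        symm
        refine Finset.sum_subset (Finset.subset_univ _) fun x _ hx => ?_
        rw [mem_filter, not_and, not_le] at hx
        have hxk := hx (mem_univ x)
        rcases Finset.eq_empty_or_nonempty {t ∈ Ico s T | b t = x} with h | ⟨t, ht⟩
        · simp [h]
        · obtain ⟨htI, rfl⟩ := mem_filter.1 ht
          have h1 := (hb t (mem_Ico.1 htI).1 (mem_Ico.1 htI).2).2.2.1
          have h2 : θ a ≤ θ (b t) := hanti (Fin.le_def.2 (by simp only [ha]; omega))
          rw [le_antisymm h1 h2]
          simp
    _ ≤ ∑ x with k ≤ x.val, (regretMax θ k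
          + 4 * α * Real.log T / k * ((θ a - θ x) / gapConst θ k a x ^ 2)) := by
        refine Finset.sum_le_sum fun x hx => ?_
        have hxk := (mem_filter.1 hx).2
        have hxa : θ x ≤ θ a := hanti (Fin.le_def.2 (by simp only [ha]; omega))
        have h1 := mul_le_mul_of_nonneg_right (hcount x hxk)
          (div_nonneg (sub_nonneg.2 hxa) hk0.le)
        have h2 := swap_regret_le_regretMax hanti (by omega) hkn.le x (by omega)
        refine h1.trans ?_
        rw [add_mul, one_mul, add_comm]
        refine add_le_add h2 (le_of_eq ?_)
        ring
    _ = _ := by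
        rw [Finset.sum_add_distrib, ← Finset.mul_sum, Finset.sum_const, nsmul_eq_mul]
        congr 2
        have e : (univ.filter fun x : Fin n => k ≤ x.val) = Finset.Ici ⟨k, hkn⟩ := by
          ext x
          simp [Fin.le_def]
        rw [e, Fin.card_Ici]
        simp only
        rw [Nat.cast_sub hkn.le]

/-- If `x` is at most `c + D ln x`, then `x` is at most `2 c + 2 D ln (2 D) - 2 D`. -/
theorem le_of_le_add_mul_log {x c D : ℝ} (hx : 0 ≤ x) (hD : 2 ≤ D) (h : x ≤ c + D * Real.log x) :
    x ≤ 2 * c + 2 * D * Real.log (2 * D) - 2 * D := by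
  have hlog : Real.log x ≤ x / (2 * D) + Real.log (2 * D) - 1 := by
    rcases hx.eq_or_lt with rfl | hx
    · rw [Real.log_zero, zero_div, zero_add, sub_nonneg,
        Real.le_log_iff_exp_le (by linarith)]
      linarith [Real.exp_one_lt_d9]
    · have h1 := Real.log_le_sub_one_of_pos (div_pos hx (show 0 < 2 * D by linarith))
      rw [Real.log_div hx.ne' (by linarith)] at h1
      linarith
  have h2 := mul_le_mul_of_nonneg_left hlog (show 0 ≤ D by linarith)
  have e : D * (x / (2 * D) + Real.log (2 * D) - 1) = x / 2 + D * Real.log (2 * D) - D := by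
    have : D ≠ 0 := by linarith
    field_simp
  rw [e] at h2
  linarith

include hθ hanti hα hu₀ hrun in
/-- The regret of a run whose confidence bounds are valid from round `N` on.  The constant `12` is
what is left of `2 D̄` after all additive constants are paid for; it later covers the rounding in
the bound on the expectation of `N`. -/
theorem IsRun.regret_le (hk : 2 ≤ k) (hkn : k < n)
    (hgap : θ ⟨k, hkn⟩ < θ ⟨k - 1, Nat.sub_lt_of_lt hkn⟩) {N : ℕ} (hN : N ≤ T)
    (hgood : ∀ t, N ≤ t → t < T → ¬ BoundFails α θ (t + 1) (W t)) :
    ∑ t ∈ range T, instRegret θ k (R t) ≤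
      (2 * N + 2 * progressConst α θ k * Real.log (2 * progressConst α θ k) - 12)
          * regretMax θ k
        + 4 * α * Real.log T / k * ∑ b : Fin n with k ≤ b.val,
          (θ ⟨k - 1, Nat.sub_lt_of_lt hkn⟩ - θ b)
            / gapConst θ k ⟨k - 1, Nat.sub_lt_of_lt hkn⟩ b ^ 2 := by
  classical
  have hk0 : (0 : ℝ) < k := by exact_mod_cast (by omega : 0 < k)
  have hk2 : (2 : ℝ) ≤ k := by exact_mod_cast hk
  have hn3 : (k : ℝ) + 1 ≤ n := by exact_mod_cast hkn
  have hΔ := regretMax_nonneg hanti (by omega : 1 ≤ k) hkn.le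
  have hM := le_tripleCount hanti hk hkn hgap
  have hD := four_mul_tripleCount_le (k := k) hθ hα
  set D := progressConst α θ k with hDdef
  set M := tripleCount θ k with hMdef
  obtain ⟨s, hNs, hsT, huns, hset⟩ : ∃ s, N ≤ s ∧ s ≤ T ∧
      (∀ t, N ≤ t → t < s → ¬ ∃ S, TopSlots θ (B t) (k - 1) S) ∧
      (s < T → ∃ S, TopSlots θ (B s) (k - 1) S) := by
    by_cases hex : ∃ t, N ≤ t ∧ t < T ∧ ∃ S, TopSlots θ (B t) (k - 1) S
    · have hspec := Nat.find_spec hex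
      refine ⟨Nat.find hex, hspec.1, hspec.2.1.le, fun t h1 h2 h3 => ?_, fun _ => hspec.2.2⟩
      exact Nat.find_min hex h2 ⟨h1, h2.trans hspec.2.1, h3⟩
    · exact ⟨T, hN, le_rfl, fun t h1 h2 h3 => hex ⟨t, h1, h2, h3⟩, fun h => absurd h (lt_irrefl T)⟩
  have hs1 := hrun.unsettled_le hθ hanti hα hu₀ hkn hNs hsT
    (fun t h1 h2 => hgood t h1 (h2.trans_le hsT)) huns
  have hs2 := hrun.card_uncertain_le hθ hα (N := N) hsT
  have hs3 : (s : ℝ) ≤ N + (k - 1) + M + D * Real.log s := by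
    have h1 : (s : ℝ) ≤ ((N + (k - 1) +
      #{t ∈ Ico N s | Uncertain α θ k (t + 1) (W t) (R t)} : ℕ) : ℝ) := by exact_mod_cast hs1
    push_cast [Nat.cast_sub (show 1 ≤ k by omega)] at h1
    linarith
  have hs4 := le_of_le_add_mul_log (Nat.cast_nonneg s) (by linarith) hs3
  have hfirst : ∑ t ∈ range s, instRegret θ k (R t) ≤ s * regretMax θ k := by
    refine (Finset.sum_le_card_nsmul _ _ (regretMax θ k) fun t ht => ?_).trans_eq ?_
    · exact instRegret_le_regretMax hanti (by omega) hkn.le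
        (hrun.card_eq t ((mem_range.1 ht).trans_le hsT))
    · rw [card_range, nsmul_eq_mul]
  have hlast : ∑ t ∈ Ico s T, instRegret θ k (R t) ≤ ((n : ℝ) - k) * regretMax θ k
      + 4 * α * Real.log T / k * ∑ b : Fin n with k ≤ b.val,
          (θ ⟨k - 1, Nat.sub_lt_of_lt hkn⟩ - θ b)
            / gapConst θ k ⟨k - 1, Nat.sub_lt_of_lt hkn⟩ b ^ 2 := by
    rcases hsT.lt_or_eq with hlt | rfl
    · obtain ⟨S, hS⟩ := hset hlt
      exact hrun.settled_regret_le hθ hanti hα hu₀ hk hkn hgap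
        (fun t h1 h2 => hgood t (hNs.trans h1) h2) hS
    · rw [Finset.Ico_self, Finset.sum_empty]
      refine add_nonneg (mul_nonneg (by linarith) hΔ) (mul_nonneg ?_ ?_)
      · exact div_nonneg (mul_nonneg (by linarith) (Real.log_natCast_nonneg s)) hk0.le
      · refine Finset.sum_nonneg fun b hb => div_nonneg (sub_nonneg.2 (hanti ?_)) (sq_nonneg _)
        have := (mem_filter.1 hb).2
        exact Fin.le_def.2 (by simp only; omega)
  rw [← Finset.sum_range_add_sum_Ico _ hsT]
  have hfin : (s : ℝ) + (n - k) ≤ 2 * N + 2 * D * Real.log (2 * D) - 12 := by linarith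
  have := mul_le_mul_of_nonneg_right hfin hΔ
  linarith

end Run

/-! ### Histories as runs -/

section History

variable {n k : ℕ} {θ : Fin n → ℝ} (hθ : ∀ i, 0 < θ i) (hk : 1 ≤ k) (hkn : k ≤ n) (α : ℝ)
  (u₀ : EReal) (τ : HistRule n k)

/-- The first `t` rankings of an infinite sequence. -/
def segment (ω : ℕ → Fin k → Fin n) (t : ℕ) : Fin t → Fin k → Fin n := fun i => ω i

theorem segment_succ (ω : ℕ → Fin k → Fin n) (t : ℕ) :
    segment ω (t + 1) = (Fin.snoc (segment ω t) (ω t) : Fin (t + 1) → Fin k → Fin n) := by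
  rw [← Fin.snoc_init_self (segment ω (t + 1))]
  rfl

theorem exists_segment (h1 : 1 ≤ n) {T : ℕ} (h : Fin T → Fin k → Fin n) :
    ∃ ω : ℕ → Fin k → Fin n, h = segment ω T := by
  refine ⟨fun t => if ht : t < T then h ⟨t, ht⟩ else fun _ => ⟨0, h1⟩, ?_⟩
  funext i
  simp [segment]

theorem regret_segment (ω : ℕ → Fin k → Fin n) (T : ℕ) :
    regret θ α u₀ τ T (segment ω T)
      = ∑ t ∈ range T, instRegret θ k (played α u₀ τ t (segment ω t)) := by
  induction T with
  | zero => rfl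
  | succ T ih => rw [Finset.sum_range_succ, ← ih]; rfl

theorem not_boundFails_of_lastFailure_le (ω : ℕ → Fin k → Fin n) (T : ℕ) {t : ℕ}
    (h1 : lastFailure α u₀ τ θ T (segment ω T) ≤ t) (h2 : t < T) :
    ¬ BoundFails α θ (t + 1) (memory α u₀ τ t (segment ω t)).W := by
  induction T with
  | zero => omega
  | succ T ih =>
    rw [lastFailure] at h1
    split_ifs at h1 with hf
    · omega
    · rcases Nat.lt_succ_iff_lt_or_eq.1 h2 with h2 | rfl
      · exact ih h1 h2
      · exact hf

include hk hkn in
theorem isRun_segment (ω : ℕ → Fin k → Fin n) (T : ℕ)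
    (h0 : law hθ hk hkn α u₀ τ T (segment ω T) ≠ 0) :
    IsRun α u₀ k T (fun t => (memory α u₀ τ t (segment ω t)).W)
      (fun t => (memory α u₀ τ t (segment ω t)).B) (fun t => played α u₀ τ t (segment ω t)) where
  step t _ := ⟨τ t (segment ω t), rfl⟩
  card_eq t _ := card_played hk hkn α u₀ τ t _
  mono t _ i j := by
    rw [segment_succ, memory_snoc_W]
    exact Nat.le_add_right _ _
  compare t ht i hi j hj hij := by
    have hr : rankProb θ (played α u₀ τ t (segment ω t)) (ω t) ≠ 0 := by
      induction T with
      | zero => omega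
      | succ T ih =>
        rw [segment_succ] at h0
        obtain ⟨h1, h2⟩ := law_snoc_ne_zero hθ hk hkn α u₀ τ h0
        rcases Nat.lt_succ_iff_lt_or_eq.1 ht with ht | rfl
        · exact ih h1 ht
        · exact h2
    rw [segment_succ, memory_snoc_W, memory_snoc_W]
    rcases breakRank_dichotomy hr (card_played hk hkn α u₀ τ t _) hij hi hj with h | h <;>
      rw [h.1, h.2] <;> omega

end History

end

end RecMaxMin

theorem theorem7 (n k : ℕ) (hk : 2 ≤ k) (hkn : k < n)
    (θ : Fin n → ℝ) (hθ : ∀ i, 0 < θ i) (hanti : Antitone θ)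
    (hgap : θ ⟨k, hkn⟩ < θ ⟨k - 1, by omega⟩)
    (α : ℝ) (hα : 1 < α) (u₀ : EReal) (hu₀ : 1 ≤ u₀)
    (τ : RecMaxMin.HistRule n k) (T : ℕ) :
    RecMaxMin.expRegret hθ (by omega : 1 ≤ k) hkn.le α u₀ τ T ≤
      (2 * (2 * α * (n : ℝ) ^ 2 / (2 * α - 1)) ^ (1 / (2 * α - 1)) * ((2 * α - 1) / (α - 1))
          + 2 * RecMaxMin.progressConst α θ k * Real.log (2 * RecMaxMin.progressConst α θ k))
        * RecMaxMin.regretMax θ k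
      + 4 * α * Real.log T / k *
        ∑ b : Fin n with k ≤ b.val,
          (θ ⟨k - 1, by omega⟩ - θ b) / RecMaxMin.gapConst θ k ⟨k - 1, by omega⟩ b ^ 2 := by
  have hk1 : 1 ≤ k := by omega
  have hΔ := RecMaxMin.regretMax_nonneg hanti hk1 hkn.le
  have hE := RecMaxMin.expect_lastFailure_le hθ hk1 hkn.le α u₀ τ hα T
  set L := 4 * α * Real.log T / k * ∑ b : Fin n with k ≤ b.val,
    (θ ⟨k - 1, by omega⟩ - θ b) / RecMaxMin.gapConst θ k ⟨k - 1, by omega⟩ b ^ 2 with hL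
  set D := RecMaxMin.progressConst α θ k with hD
  set Δ := RecMaxMin.regretMax θ k with hΔdef
  set x := (2 * α * (n : ℝ) ^ 2 / (2 * α - 1)) ^ (1 / (2 * α - 1)) with hx
  have hx0 : 0 ≤ x :=
    Real.rpow_nonneg (div_nonneg (mul_nonneg (by linarith) (sq_nonneg _)) (by linarith)) _
  calc RecMaxMin.expRegret hθ hk1 hkn.le α u₀ τ T
      ≤ RecMaxMin.expect hθ hk1 hkn.le α u₀ τ T fun h =>
          2 * Δ * (RecMaxMin.lastFailure α u₀ τ θ T h : ℝ)
            + ((2 * D * Real.log (2 * D) - 12) * Δ + L) := by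
        refine RecMaxMin.expect_mono hθ hk1 hkn.le α u₀ τ fun h h0 => ?_
        obtain ⟨ω, rfl⟩ := RecMaxMin.exists_segment (by omega) h
        rw [RecMaxMin.regret_segment]
        have := (RecMaxMin.isRun_segment hθ hk1 hkn.le α u₀ τ ω T h0).regret_le hθ hanti hα hu₀
          hk hkn hgap (RecMaxMin.lastFailure_le (θ := θ) α u₀ τ T (RecMaxMin.segment ω T))
          (fun t h1 h2 => RecMaxMin.not_boundFails_of_lastFailure_le α u₀ τ ω T h1 h2)
        refine this.trans (le_of_eq ?_)
        ring
    _ = 2 * Δ * RecMaxMin.expect hθ hk1 hkn.le α u₀ τ T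
            (fun h => (RecMaxMin.lastFailure α u₀ τ θ T h : ℝ))
          + ((2 * D * Real.log (2 * D) - 12) * Δ + L) := by
        rw [RecMaxMin.expect_add, RecMaxMin.expect_const_mul, RecMaxMin.expect_const]
    _ ≤ 2 * Δ * (x * ((2 * α - 1) / (2 * α - 2)) + 2)
          + ((2 * D * Real.log (2 * D) - 12) * Δ + L) := by
        gcongr
    _ ≤ _ := by
        set y := x * ((2 * α - 1) / (2 * α - 2)) with hy
        have hy0 : 0 ≤ y := mul_nonneg hx0 (div_nonneg (by linarith) (by linarith))
        have e : 2 * x * ((2 * α - 1) / (α - 1)) = 4 * y := by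
          rw [hy, show 2 * α - 2 = 2 * (α - 1) by ring]
          have : α - 1 ≠ 0 := by linarith
          field_simp
          ring
        rw [e]
        have := mul_nonneg hy0 hΔ
        linarith
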